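/- **Theorem 4.4.** For an integer $N\ge 1$ let $\epsilon=1/N$ and $\Lambda_N=[-N,N]\cap\mathbb Z$. Let $(\Omega,\mathbf P_\epsilon)$ carry the active/passive marks process: to the pairs $\{x,x+1\}$, $x\in\mathbb Z$, are attached mutually independent Poisson point processes on $[0,\infty)$ of intensity $\epsilon^{-2}$; their points are called marks, and each mark is independently declared active or passive with probability $\tfrac12$ each. A particle in $\Lambda_N$ moves as follows: as soon as an active mark appears at a pair $\{x,y\}$, where $x$ is the position of the particle and $y\in\Lambda_N$ is a neighbour of $x$, the particle moves to $y$ (a particle at $y$ then simultaneously moves to $x$). Passive marks, and marks at pairs not contained in $\Lambda_N$, do not move particles. For $x_1,x_2\in\Lambda_N$ let $x_1(s),x_2(s)$ be the (right-continuous) positions at time $s$ of the particles that start at time $0$ from $x_1,x_2$, all particles being driven by the same marks. Let $\tau_{x_1,x_2}\in[0,\infty]$ be the smallest time $s\ge 0$ such that $|x_1(s)-x_2(s)|=1$ and at time $s$ a mark (active or passive) appears at the pair $\{x_1(s),x_2(s)\}$, with $\tau_{x_1,x_2}=\infty$ if there is none, and let $N_{x_1,x_2,t}$ be the number of such times $s$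 in $[0,t]$. 1. There is a constant $c$ such that for all $N\ge1$, with $\epsilon=1/N$, and all $t\ge 0$, $$\sup_{x_1,x_2\in\Lambda_N:\ |x_1-x_2|=1}\mathbf P_\epsilon\big[\tau_{x_1,x_2}\ge t\big]\le\frac{c}{(\epsilon^{-2}t)^{1/2}+1}.$$ 2. For every $T>0$, every $\zeta>0$ and every real $k\ge 1$ there is a constant $c$ such that for all $t\in(0,T]$ and all $N\ge 1$, with $\epsilon=1/N$, $$\sup_{x_1,x_2\in\Lambda_N}\mathbf P_\epsilon\big[N_{x_1,x_2,t}\ge(\epsilon^{-2}t)^{1/2+\zeta}\big]\le c\,(\epsilon^{-2}t)^{-k}.$$ -/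

import Mathlib

open MeasureTheory ProbabilityTheory

noncomputable section

namespace Stirring

/-- A realization of the marks. The integer `b` stands for the pair of sites `{b, b + 1}`;
`(ω b n).1` is the waiting time of the `n`-th mark at that pair after the previous one
(after time `0` if `n = 0`), and `(ω b n).2` is its attribute, `true` for active and
`false` for passive. -/
abbrev Marks : Type := ℤ → ℕ → ℝ × Bool

/-- Law of one waiting time together with the attribute of the mark that ends it: an exponential
time of rate `ε⁻²` and, independently, a fair attribute. -/
def markLaw (ε : ℝ) : Measure (ℝ × Bool) :=
  (expMeasure (ε⁻¹ ^ 2)).prod (PMF.uniformOfFintype Bool).toMeasure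

theorem isProbabilityMeasure_markLaw {ε : ℝ} (hε : 0 < ε) :
    IsProbabilityMeasure (markLaw ε) := by
  have : IsProbabilityMeasure (expMeasure (ε⁻¹ ^ 2)) :=
    isProbabilityMeasure_expMeasure (by positivity)
  unfold markLaw
  infer_instance

/-- The law of the active/passive marks process: independent Poisson processes of
intensity `ε⁻²` on `[0, ∞)`, one for each pair `{b, b + 1}` with `b ∈ ℤ` (independent exponential
waiting times), whose points carry independent fair attributes. -/
def marksLaw (ε : ℝ) : Measure Marks :=
  Measure.infinitePi fun _ : ℤ => Measure.infinitePi fun _ : ℕ => markLaw ε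

theorem isProbabilityMeasure_marksLaw {ε : ℝ} (hε : 0 < ε) :
    IsProbabilityMeasure (marksLaw ε) := by
  have := isProbabilityMeasure_markLaw hε
  unfold marksLaw
  infer_instance

/-- The time of the `n`-th mark at the pair `{b, b + 1}`. -/
def markTime (ω : Marks) (b : ℤ) (n : ℕ) : ℝ := ∑ i ∈ Finset.range (n + 1), (ω b i).1

/-- A mark, active or passive, appears at time `s` at the pair `{b, b + 1}`. -/
def IsMark (ω : Marks) (b : ℤ) (s : ℝ) : Prop := ∃ n, markTime ω b n = s

/-- An active mark appears at time `s` at the pair `{b, b + 1}`. -/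
def IsActiveMark (ω : Marks) (b : ℤ) (s : ℝ) : Prop :=
  ∃ n, markTime ω b n = s ∧ (ω b n).2 = true

/-- The interval `Λ_N = [-N, N]` of `ℤ`. -/
def box (N : ℕ) : Finset ℤ := Finset.Icc (-(N : ℤ)) N

/-- The integers `b` for which both sites of the pair `{b, b + 1}` are in `Λ_N`. -/
def bonds (N : ℕ) : Finset ℤ := (box N).filter fun b => b + 1 ∈ box N

/-- The times of the marks at the pairs contained in `Λ_N`. -/
def markTimes (N : ℕ) (ω : Marks) : Set ℝ := {s | ∃ b ∈ bonds N, IsMark ω b s}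

/-- `epoch N ω n` is the `n`-th positive time at which a mark appears in `Λ_N`, with
`epoch N ω 0 = 0`. Almost surely the mark times have no accumulation point, so that the
infimum is a minimum. -/
def epoch (N : ℕ) (ω : Marks) : ℕ → ℝ
  | 0 => 0
  | n + 1 => sInf {s | s ∈ markTimes N ω ∧ epoch N ω n < s}

open Classical in
/-- Effect of the marks at time `s` on a particle at `x`: it moves to the neighbour `y ∈ Λ_N` if
there is an active mark at the pair `{x, y}`. -/
def move (N : ℕ) (ω : Marks) (s : ℝ) (x : ℤ) : ℤ :=
  if x ∈ bonds N ∧ IsActiveMark ω x s then x + 1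
  else if x - 1 ∈ bonds N ∧ IsActiveMark ω (x - 1) s then x - 1
  else x

/-- The position, just after the `n`-th epoch, of the particle that starts from `x`. -/
def skeleton (N : ℕ) (ω : Marks) (x : ℤ) : ℕ → ℤ
  | 0 => x
  | n + 1 => move N ω (epoch N ω (n + 1)) (skeleton N ω x n)

/-- The position at time `t` of the particle that starts from `x`; the path is constant between
mark times and right continuous. -/
def position (N : ℕ) (ω : Marks) (x : ℤ) (t : ℝ) : ℤ :=
  skeleton N ω x (Set.ncard {s | s ∈ markTimes N ω ∧ 0 < s ∧ s ≤ t})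

/-- The set of the times `s ≥ 0` at which the particles that start from `x₁`, `x₂` are at
distance `1`. -/
def contactTimes (N : ℕ) (x₁ x₂ : ℤ) (ω : Marks) : Set ℝ :=
  {s | 0 ≤ s ∧ |position N ω x₁ s - position N ω x₂ s| = 1}

/-- The triples `(s, y₁, y₂)` with `s` a contact time, `yᵢ` the positions of the two particles at
time `s`, such that at time `s` a mark, active or passive, appears between `y₁` and `y₂`. -/
def contactMarks (N : ℕ) (x₁ x₂ : ℤ) (ω : Marks) : Set (ℝ × ℤ × ℤ) :=
  {p | p.1 ∈ contactTimes N x₁ x₂ ω ∧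
    p.2.1 = position N ω x₁ p.1 ∧ p.2.2 = position N ω x₂ p.1 ∧
    IsMark ω (min p.2.1 p.2.2) p.1}

/-- The first time of a mark between the two particles, `⊤` if there is none. -/
def tau (N : ℕ) (x₁ x₂ : ℤ) (ω : Marks) : EReal :=
  ⨅ p ∈ contactMarks N x₁ x₂ ω, (p.1 : EReal)

/-- The number of marks between the two particles in the time interval `[0, t]`. -/
def numMarks (N : ℕ) (x₁ x₂ : ℤ) (t : ℝ) (ω : Marks) : ℕ∞ :=
  Set.encard {p | p ∈ contactMarks N x₁ x₂ ω ∧ p.1 ≤ t}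

end Stirring

end

/-! The two particles, driven by the marks at `bonds N`, form a continuous-time Markov chain. Both
estimates come from a comparison principle: the probability of an event of this chain is at most any
nonnegative supersolution of its backward equation that is at least `1` on the target states at time
`0`. No semigroup is constructed. The marks process regenerates at its first mark
(`marksLaw_first_mark`), which yields a renewal inequality for the events `cascade`; iterating it
(`marksLaw_cascade_le`) leaves an error `2⁻ⁿ exp (l t)`, with `l` the total rate of marks, for
realizations with `n` marks before `t`, and `n → ∞` removes it. Almost every realization in the
events of the theorem lies in all the corresponding cascades (`Regular.mem_cascade_of_le_tau`,
`Regular.mem_cascade_of_le_numMarks`).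

Write `s = ε⁻² t`. For the first estimate, the distance of the particles is, away from the walls, a
symmetric walk killed at `0`: a mark of either kind between neighbours has the same rate as the two
inward moves together. From distance `1` the walk reaches `M` before `0` with probability `1/M`, and
its mean exit time from `(0, M)` is `(M - 1)/2` in the time unit `ε²`. Markov's inequality gives the
bound `1/M + M/(2s)`, and `M = ⌊√s⌋` is chosen. Walls only suppress outward moves, which is harmless
because the supersolution increases with the distance (`survivalBound_generator_of_lt`).

For the second estimate, a Chernoff bound is run with the Lyapunov function `pairWeight`, whose
values are between `1` and `6`. Its slope at contact, of order `-1/M`, pays for a factor `1 +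
1/(4M)` at every mark between the particles; wall terms pay for the suppressed outward moves; the
remaining growth rate is `7ε⁻²/M²` (`pairWeight_generator`). Hence the probability of at least `j`
marks is at most `6 exp (7s/M²) (1 + 1/(4M))⁻ʲ`. With `M` of order `√(s/T)` the exponential is
bounded, and `j ≥ s^(1/2 + ζ)` exceeds `M` by a power of `s`. -/

noncomputable section

namespace Stirring

open scoped ENNReal
open Measure

/-! ### Transformations of infinite product measures. -/

section Product

variable {ι : Type*} [DecidableEq ι] {X : ι → Type*} [∀ i, MeasurableSpace (X i)]
  (μ : (i : ι) → Measure (X i)) [∀ i, IsProbabilityMeasure (μ i)]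

/-- Resampling one coordinate preserves a product measure. -/
theorem measurePreserving_update_infinitePi (i : ι) :
    MeasurePreserving (fun p : X i × (Π j, X j) => Function.update p.2 i p.1)
      ((μ i).prod (infinitePi μ)) (infinitePi μ) := by
  have hm : Measurable (fun p : X i × (Π j, X j) => Function.update p.2 i p.1) := by
    refine measurable_pi_lambda _ fun j => ?_
    by_cases h : j = i
    · subst h; simpa using measurable_fst
    · simp only [Function.update_of_ne h]
      fun_prop
  refine ⟨hm, eq_infinitePi _ fun s t ht => ?_⟩
  have hpre : (fun p : X i × (Π j, X j) => Function.update p.2 i p.1) ⁻¹' (Set.pi s t) =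
      (if i ∈ s then t i else Set.univ) ×ˢ (Set.pi (s.erase i) t) := by
    ext ⟨q, ω⟩
    simp only [Set.mem_preimage, Set.mem_pi, Set.mem_prod, Finset.mem_coe, Finset.mem_erase]
    constructor
    · intro h
      refine ⟨?_, fun j hj => ?_⟩
      · split_ifs with his
        · simpa using h i his
        · trivial
      · simpa [Function.update_of_ne hj.1] using h j hj.2
    · rintro ⟨h1, h2⟩ j hj
      by_cases hji : j = i
      · subst hji; simpa [hj] using h1
      · simpa [Function.update_of_ne hji] using h2 j ⟨hji, hj⟩
  rw [map_apply hm (.pi s.countable_toSet fun j _ => ht j), hpre, prod_prod,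
    infinitePi_pi _ fun j _ => ht j]
  split_ifs with his
  · exact Finset.mul_prod_erase s (fun j => μ j (t j)) his
  · simp [Finset.erase_eq_of_notMem his]

/-- Conditioning finitely many coordinates of a product measure, and then transforming them so that
their laws are recovered, recovers the product measure. -/
theorem infinitePi_inter_preimage (J : Finset ι) {E : (i : ι) → Set (X i)}
    (hE : ∀ i, MeasurableSet (E i)) {f : (i : ι) → X i → X i} (hf : ∀ i, Measurable (f i))
    {c : ℝ≥0∞} (hc0 : c ≠ 0) (hct : c ≠ ⊤)
    (h : ∀ i ∈ J, ∀ A, MeasurableSet A → μ i (E i ∩ f i ⁻¹' A) = c * μ i A)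
    {A : Set (Π i, X i)} (hA : MeasurableSet A) :
    infinitePi μ ({ω | ∀ i ∈ J, ω i ∈ E i} ∩
      (fun (ω : Π i, X i) i => if i ∈ J then f i (ω i) else ω i) ⁻¹' A) =
        c ^ J.card * infinitePi μ A := by
  set F : (Π i, X i) → (Π i, X i) := fun ω i => if i ∈ J then f i (ω i) else ω i with hF
  set D : Set (Π i, X i) := {ω | ∀ i ∈ J, ω i ∈ E i} with hD
  have hFm : Measurable F := by
    refine measurable_pi_lambda _ fun j => ?_
    by_cases hj : j ∈ J
    · simp only [hF, hj, if_true]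
      have := hf j
      fun_prop
    · simp only [hF, hj, if_false]
      fun_prop
  have hC0 : c ^ J.card ≠ 0 := pow_ne_zero _ hc0
  have hCt : c ^ J.card ≠ ⊤ := ENNReal.pow_ne_top hct
  have key : (c ^ J.card)⁻¹ • ((infinitePi μ).restrict D).map F = infinitePi μ := by
    refine eq_infinitePi _ fun s t ht => ?_
    have hms : MeasurableSet (Set.pi (s : Set ι) t) := .pi s.countable_toSet fun j _ => ht j
    -- Coordinates of `J` not seen by the box get the trivial constraint, so that every element of
    -- `J` contributes its factor `c`.
    let t' : (i : ι) → Set (X i) := fun i => if i ∈ s then t i else Set.univ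
    have ht' : ∀ i, MeasurableSet (t' i) := fun i => by
      by_cases hi : i ∈ s <;> simp [t', hi, ht i]
    have hset : F ⁻¹' (Set.pi s t) ∩ D =
        Set.pi (s ∪ J : Finset ι) (fun i => if i ∈ J then E i ∩ f i ⁻¹' (t' i) else t' i) := by
      ext ω
      simp only [Set.mem_inter_iff, Set.mem_preimage, Set.mem_pi, Finset.mem_coe, hD,
        Set.mem_ofPred_eq, hF, Finset.mem_union]
      constructor
      · rintro ⟨h1, h2⟩ i hi
        by_cases hJ : i ∈ J
        · rw [if_pos hJ]
          refine ⟨h2 i hJ, ?_⟩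
          by_cases hs : i ∈ s
          · have := h1 i hs
            simp only [hJ, if_true] at this
            simpa [t', hs] using this
          · simp [t', hs]
        · have hs : i ∈ s := by tauto
          have := h1 i hs
          simp only [hJ, if_false] at this
          simpa [hJ, t', hs] using this
      · intro h1
        refine ⟨fun i hs => ?_, fun i hJ => ?_⟩
        · have := h1 i (Or.inl hs)
          by_cases hJ : i ∈ J
          · simp only [hJ, if_true] at this ⊢
            simpa [t', hs] using this.2
          · simpa [hJ, t', hs] using this
        · have := h1 i (Or.inr hJ)
          simp only [hJ, if_true] at this
          exact this.1
    rw [Measure.smul_apply, map_apply hFm hms, restrict_apply (hFm hms), hset,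
      infinitePi_pi, smul_eq_mul]
    · have e1 : ∏ i ∈ s ∪ J, μ i (if i ∈ J then E i ∩ f i ⁻¹' (t' i) else t' i) =
          ∏ i ∈ s ∪ J, ((if i ∈ J then c else 1) * μ i (t' i)) := by
        refine Finset.prod_congr rfl fun i _ => ?_
        by_cases hJ : i ∈ J
        · simp [hJ, h i hJ _ (ht' i)]
        · simp [hJ]
      have e2 : ∏ i ∈ s ∪ J, (if i ∈ J then c else 1) = c ^ J.card := by
        rw [Finset.prod_ite, Finset.prod_const, Finset.prod_const_one, mul_one]
        congr 2
        ext i; simp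
      have e3 : ∏ i ∈ s ∪ J, μ i (t' i) = ∏ i ∈ s, μ i (t i) := by
        rw [← Finset.prod_subset (Finset.subset_union_left (s₁ := s) (s₂ := J))]
        · exact Finset.prod_congr rfl fun i hi => by simp [t', hi]
        · intro i _ hi
          simp [t', hi]
      rw [e1, Finset.prod_mul_distrib, e2, e3, ← mul_assoc, ENNReal.inv_mul_cancel hC0 hCt, one_mul]
    · intro i _
      by_cases hJ : i ∈ J
      · simpa [hJ] using (hE i).inter (hf i (ht' i))
      · simpa [hJ] using ht' i
  have h2 := congrArg (fun ν => ν A) key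
  simp only [Measure.smul_apply, map_apply hFm hA, restrict_apply (hFm hA), smul_eq_mul] at h2
  rw [Set.inter_comm, ← h2, ← mul_assoc, ENNReal.mul_inv_cancel hC0 hCt, one_mul]

end Product

/-- Put an element in front of a sequence. -/
def consSeq {E : Type*} (e : E) (q : ℕ → E) : ℕ → E
  | 0 => e
  | n + 1 => q n

@[simp] theorem consSeq_zero {E : Type*} (e : E) (q : ℕ → E) : consSeq e q 0 = e := rfl

@[simp] theorem consSeq_succ {E : Type*} (e : E) (q : ℕ → E) (n : ℕ) :
    consSeq e q (n + 1) = q n := rfl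

theorem measurable_consSeq {E : Type*} [MeasurableSpace E] :
    Measurable (fun p : E × (ℕ → E) => consSeq p.1 p.2) := by
  refine measurable_pi_lambda _ fun n => ?_
  cases n with
  | zero => exact measurable_fst
  | succ n => exact (measurable_pi_apply n).comp measurable_snd

/-- An independent element in front of an i.i.d. sequence gives an i.i.d. sequence. -/
theorem measurePreserving_consSeq {E : Type*} [MeasurableSpace E] (ν : Measure E)
    [IsProbabilityMeasure ν] :
    MeasurePreserving (fun p : E × (ℕ → E) => consSeq p.1 p.2)
      (ν.prod (infinitePi fun _ : ℕ => ν)) (infinitePi fun _ : ℕ => ν) := by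
  refine ⟨measurable_consSeq, eq_infinitePi _ fun s t ht => ?_⟩
  set s' : Finset ℕ := s.preimage Nat.succ Nat.succ_injective.injOn with hs'
  have hpre : (fun p : E × (ℕ → E) => consSeq p.1 p.2) ⁻¹' (Set.pi s t) =
      (if 0 ∈ s then t 0 else Set.univ) ×ˢ (Set.pi s' fun n => t (n + 1)) := by
    ext ⟨e, q⟩
    simp only [Set.mem_preimage, Set.mem_pi, Set.mem_prod, Finset.mem_coe, hs', Finset.mem_preimage]
    constructor
    · intro h
      refine ⟨?_, fun n hn => h (n + 1) hn⟩
      split_ifs with h0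
      · exact h 0 h0
      · trivial
    · rintro ⟨h1, h2⟩ n hn
      cases n with
      | zero => simpa [hn] using h1
      | succ n => exact h2 n hn
  rw [map_apply measurable_consSeq (.pi s.countable_toSet fun j _ => ht j), hpre, prod_prod,
    infinitePi_pi _ fun j _ => ht _]
  have h1 : ∏ n ∈ s', ν (t (n + 1)) = ∏ n ∈ s.erase 0, ν (t n) := by
    refine Finset.prod_bij (fun n _ => n + 1) ?_ ?_ ?_ ?_
    · intro n hn
      simpa [hs'] using hn
    · intro a _ b _ hab
      simpa using hab
    · intro n hn
      rw [Finset.mem_erase] at hn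
      obtain ⟨k, rfl⟩ := Nat.exists_eq_succ_of_ne_zero hn.1
      exact ⟨k, by simpa [hs'] using hn.2, rfl⟩
    · intros; rfl
  rw [h1]
  split_ifs with h0
  · exact Finset.mul_prod_erase s (fun n => ν (t n)) h0
  · simp [Finset.erase_eq_of_notMem h0]

theorem expMeasure_eq_withDensity (r : ℝ) :
    expMeasure r = volume.withDensity (exponentialPDF r) := rfl

theorem lintegral_expMeasure {r : ℝ} {f : ℝ → ℝ≥0∞} (hf : Measurable f) :
    ∫⁻ x, f x ∂(expMeasure r) =
      ∫⁻ x in Set.Ici 0, ENNReal.ofReal (r * Real.exp (-(r * x))) * f x := by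
  rw [expMeasure_eq_withDensity, lintegral_withDensity_eq_lintegral_mul _ _ hf,
    ← lintegral_indicator measurableSet_Ici]
  · congr 1
    ext x
    by_cases hx : 0 ≤ x
    · simp [Set.indicator, hx, exponentialPDF_of_nonneg hx]
    · simp [Set.indicator, hx, exponentialPDF_of_neg (not_le.1 hx)]
  · exact (measurable_exponentialPDFReal r).ennreal_ofReal

/-- The exponential law has no memory. -/
theorem expMeasure_inter_preimage_sub {r s : ℝ} (hs : 0 ≤ s) {A : Set ℝ}
    (hA : MeasurableSet A) :
    expMeasure r (Set.Ioi s ∩ (fun x => x - s) ⁻¹' A) =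
      ENNReal.ofReal (Real.exp (-(r * s))) * expMeasure r A := by
  have hm : MeasurableSet (Set.Ioi s ∩ (fun x => x - s) ⁻¹' A) :=
    measurableSet_Ioi.inter ((measurable_id.sub_const s) hA)
  have hpm : Measurable (exponentialPDF r) := (measurable_exponentialPDFReal r).ennreal_ofReal
  rw [expMeasure_eq_withDensity, withDensity_apply _ hm, withDensity_apply _ hA,
    ← lintegral_indicator hm, ← lintegral_indicator hA,
    ← lintegral_const_mul _ (hpm.indicator hA),
    ← lintegral_add_right_eq_self _ s]
  refine lintegral_congr_ae ?_
  -- The integrands disagree only at `x = 0`, where the density is positive but the strict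
  -- inequality fails.
  have : ∀ᵐ x : ℝ, x ≠ 0 := by simp [ae_iff, measure_singleton]
  filter_upwards [this] with x hx
  rcases lt_or_gt_of_ne hx with h | h
  · have : ¬ (0 < x) := not_lt.2 h.le
    simp [Set.indicator, this, exponentialPDF_of_neg h]
  · by_cases hxA : x ∈ A
    · simp only [Set.indicator, Set.mem_inter_iff, Set.mem_Ioi, lt_add_iff_pos_left, h,
        Set.mem_preimage, add_sub_cancel_right, hxA, and_self, if_true]
      rw [exponentialPDF_of_nonneg (by linarith), exponentialPDF_of_nonneg h.le,
        ← ENNReal.ofReal_mul (Real.exp_nonneg _)]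
      congr 1
      rw [mul_left_comm, ← Real.exp_add]
      congr 2
      ring
    · simp [Set.indicator, hxA]

theorem expMeasure_Ioi {r s : ℝ} (hr : 0 < r) (hs : 0 ≤ s) :
    expMeasure r (Set.Ioi s) = ENNReal.ofReal (Real.exp (-(r * s))) := by
  have := isProbabilityMeasure_expMeasure hr
  simpa using expMeasure_inter_preimage_sub (r := r) hs MeasurableSet.univ

instance nullSingletonClass_expMeasure (r : ℝ) : NullSingletonClass (expMeasure r) := by
  rw [expMeasure_eq_withDensity]; infer_instance

theorem expMeasure_Ici {r s : ℝ} (hr : 0 < r) (hs : 0 ≤ s) :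
    expMeasure r (Set.Ici s) = ENNReal.ofReal (Real.exp (-(r * s))) := by
  rw [← expMeasure_Ioi hr hs]
  exact measure_congr Ioi_ae_eq_Ici.symm

/-! ### Regeneration of the marks process at its first mark. -/

section Regeneration

variable {ε : ℝ}

theorem lintegral_markLaw (hε : 0 < ε) {f : ℝ × Bool → ℝ≥0∞} (hf : Measurable f) :
    ∫⁻ e, f e ∂(markLaw ε) =
      ∫⁻ s in Set.Ici 0, ENNReal.ofReal (ε⁻¹ ^ 2 * Real.exp (-(ε⁻¹ ^ 2 * s))) *
        (2⁻¹ * ∑ a : Bool, f (s, a)) := by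
  have : IsProbabilityMeasure (expMeasure (ε⁻¹ ^ 2)) :=
    isProbabilityMeasure_expMeasure (by positivity)
  rw [markLaw, lintegral_prod _ hf.aemeasurable, lintegral_expMeasure]
  · congr 1
    ext s
    congr 1
    rw [lintegral_fintype, Finset.mul_sum]
    refine Finset.sum_congr rfl fun a _ => ?_
    rw [PMF.toMeasure_apply_singleton _ _ (measurableSet_singleton a)]
    simp [mul_comm]
  · exact hf.lintegral_prod_right'

theorem markLaw_inter_preimage_sub (hε : 0 < ε) {s : ℝ} (hs : 0 ≤ s) {A : Set (ℝ × Bool)}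
    (hA : MeasurableSet A) :
    markLaw ε ({e | s < e.1} ∩ (fun e => (e.1 - s, e.2)) ⁻¹' A) =
      ENNReal.ofReal (Real.exp (-(ε⁻¹ ^ 2 * s))) * markLaw ε A := by
  have : IsProbabilityMeasure (expMeasure (ε⁻¹ ^ 2)) :=
    isProbabilityMeasure_expMeasure (by positivity)
  have hm : MeasurableSet ({e : ℝ × Bool | s < e.1} ∩ (fun e => (e.1 - s, e.2)) ⁻¹' A) := by
    exact (measurableSet_lt measurable_const measurable_fst).inter
      ((by fun_prop : Measurable fun e : ℝ × Bool => (e.1 - s, e.2)) hA)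
  rw [markLaw, prod_apply_symm hm, prod_apply_symm hA,
    ← lintegral_const_mul _ (measurable_measure_prodMk_right hA)]
  congr 1
  ext a
  rw [← expMeasure_inter_preimage_sub hs (measurable_prodMk_right hA)]
  rfl

/-- Let a time `s` pass on one sequence of marks. -/
def shiftHead (s : ℝ) (q : ℕ → ℝ × Bool) : ℕ → ℝ × Bool :=
  fun n => if n ∈ ({0} : Finset ℕ) then ((q n).1 - s, (q n).2) else q n

/-- The law of the marks at one pair of sites. -/
def seqLaw (ε : ℝ) : Measure (ℕ → ℝ × Bool) := infinitePi fun _ : ℕ => markLaw ε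

theorem isProbabilityMeasure_seqLaw (hε : 0 < ε) : IsProbabilityMeasure (seqLaw ε) := by
  have := isProbabilityMeasure_markLaw hε
  unfold seqLaw
  infer_instance

theorem measurable_shiftHead_prod :
    Measurable (fun p : ℝ × (ℕ → ℝ × Bool) => shiftHead p.1 p.2) := by
  refine measurable_pi_lambda _ fun n => ?_
  by_cases hn : n ∈ ({0} : Finset ℕ)
  · simp only [shiftHead, hn, if_true]
    fun_prop
  · simp only [shiftHead, hn, if_false]
    fun_prop

theorem measurable_shiftHead (s : ℝ) : Measurable (shiftHead s) :=
  measurable_shiftHead_prod.comp measurable_prodMk_left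

theorem seqLaw_inter_preimage_shiftHead (hε : 0 < ε) {s : ℝ} (hs : 0 ≤ s)
    {A : Set (ℕ → ℝ × Bool)} (hA : MeasurableSet A) :
    seqLaw ε ({q | s < (q 0).1} ∩ shiftHead s ⁻¹' A) =
      ENNReal.ofReal (Real.exp (-(ε⁻¹ ^ 2 * s))) * seqLaw ε A := by
  have := isProbabilityMeasure_markLaw hε
  have h := infinitePi_inter_preimage (fun _ : ℕ => markLaw ε) {0}
    (E := fun _ => {e | s < e.1}) (fun _ => measurableSet_lt measurable_const measurable_fst)
    (f := fun _ e => (e.1 - s, e.2)) (fun _ => by fun_prop)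
    (c := ENNReal.ofReal (Real.exp (-(ε⁻¹ ^ 2 * s))))
    (by simpa using Real.exp_pos _) ENNReal.ofReal_ne_top
    (fun _ _ A hA => markLaw_inter_preimage_sub hε hs hA) hA
  have h0 : {q : ℕ → ℝ × Bool | ∀ i ∈ ({0} : Finset ℕ), q i ∈ {e : ℝ × Bool | s < e.1}} =
      {q | s < (q 0).1} := by ext; simp
  rw [h0, Finset.card_singleton, pow_one] at h
  exact h

/-- Let a time `s` pass at the pairs in `J`. -/
def elapse (J : Finset ℤ) (s : ℝ) (ω : Marks) : Marks :=
  fun c => if c ∈ J then shiftHead s (ω c) else ω c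

theorem measurable_elapse_prod (J : Finset ℤ) :
    Measurable (fun p : ℝ × Marks => elapse J p.1 p.2) := by
  refine measurable_pi_lambda _ fun c => ?_
  by_cases hc : c ∈ J
  · simp only [elapse, hc, if_true]
    exact measurable_shiftHead_prod.comp (by fun_prop : Measurable fun p : ℝ × Marks => (p.1, p.2 c))
  · simp only [elapse, hc, if_false]
    fun_prop

/-- The marks process has no memory. -/
theorem marksLaw_inter_preimage_elapse (hε : 0 < ε) (J : Finset ℤ) {s : ℝ} (hs : 0 ≤ s)
    {A : Set Marks} (hA : MeasurableSet A) :
    marksLaw ε ({ω | ∀ c ∈ J, s < (ω c 0).1} ∩ elapse J s ⁻¹' A) =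
      ENNReal.ofReal (Real.exp (-(ε⁻¹ ^ 2 * s))) ^ J.card * marksLaw ε A := by
  have := isProbabilityMeasure_seqLaw hε
  exact infinitePi_inter_preimage (fun _ : ℤ => seqLaw ε) J
    (E := fun _ => {q | s < (q 0).1}) (fun _ => measurableSet_lt measurable_const (by fun_prop))
    (f := fun _ => shiftHead s) (fun _ => measurable_shiftHead s)
    (c := ENNReal.ofReal (Real.exp (-(ε⁻¹ ^ 2 * s))))
    (by simpa using Real.exp_pos _) ENNReal.ofReal_ne_top
    (fun _ _ A hA => seqLaw_inter_preimage_shiftHead hε hs hA) hA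

/-- Put a mark in front of those at the pair `b`. -/
def insertMark (b : ℤ) (e : ℝ × Bool) (ω : Marks) : Marks :=
  Function.update ω b (consSeq e (ω b))

@[simp] theorem insertMark_self_zero (b : ℤ) (e : ℝ × Bool) (ω : Marks) :
    insertMark b e ω b 0 = e := by simp [insertMark]

@[simp] theorem insertMark_self_succ (b : ℤ) (e : ℝ × Bool) (ω : Marks) (n : ℕ) :
    insertMark b e ω b (n + 1) = ω b n := by simp [insertMark]

theorem insertMark_of_ne {b c : ℤ} (h : c ≠ b) (e : ℝ × Bool) (ω : Marks) :
    insertMark b e ω c = ω c := by simp [insertMark, h]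

theorem measurable_insertMark (b : ℤ) :
    Measurable (fun p : (ℝ × Bool) × Marks => insertMark b p.1 p.2) := by
  refine measurable_pi_lambda _ fun c => ?_
  by_cases h : c = b
  · subst h
    simp only [insertMark, Function.update_self]
    exact measurable_consSeq.comp
      (by fun_prop : Measurable fun p : (ℝ × Bool) × Marks => (p.1, p.2 c))
  · simp only [insertMark_of_ne h]
    fun_prop

/-- This makes the first mark at `b` independent of a fresh copy of the whole process, so that it
can be integrated out by Fubini. The old sequence at `b` is discarded by resampling, which is why
`update` and `consSeq` are composed. -/
theorem measurePreserving_insertMark (hε : 0 < ε) (b : ℤ) :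
    MeasurePreserving (fun p : (ℝ × Bool) × Marks => insertMark b p.1 p.2)
      ((markLaw ε).prod (marksLaw ε)) (marksLaw ε) := by
  have := isProbabilityMeasure_markLaw hε
  have := isProbabilityMeasure_seqLaw hε
  have := isProbabilityMeasure_marksLaw hε
  have hupd : MeasurePreserving (fun p : (ℕ → ℝ × Bool) × Marks => Function.update p.2 b p.1)
      ((seqLaw ε).prod (marksLaw ε)) (marksLaw ε) :=
    measurePreserving_update_infinitePi (fun _ : ℤ => seqLaw ε) b
  have hcons : MeasurePreserving (fun p : (ℝ × Bool) × (ℕ → ℝ × Bool) => consSeq p.1 p.2)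
      ((markLaw ε).prod (seqLaw ε)) (seqLaw ε) := measurePreserving_consSeq (markLaw ε)
  have h1 := (MeasurePreserving.id (markLaw ε)).prod hupd
  have h2 := hupd.comp ((hcons.prod (MeasurePreserving.id (marksLaw ε))).comp
    ((measurePreserving_prodAssoc (markLaw ε) (seqLaw ε) (marksLaw ε)).symm))
  refine ⟨measurable_insertMark b, ?_⟩
  rw [← h1.map_eq, map_map (measurable_insertMark b) h1.measurable]
  conv_rhs => rw [← h2.map_eq]
  congr 1
  ext p : 1
  obtain ⟨e, q, ω⟩ := p
  simp [insertMark, MeasurableEquiv.prodAssoc, Equiv.prodAssoc]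

/-- The marks after the time of the first mark, if this one is at the pair `b`. -/
def afterFirst (B : Finset ℤ) (b : ℤ) (ω : Marks) : Marks :=
  elapse (B.erase b) (ω b 0).1 (Function.update ω b fun n => ω b (n + 1))

theorem afterFirst_insertMark (B : Finset ℤ) (b : ℤ) (e : ℝ × Bool) (ω : Marks) :
    afterFirst B b (insertMark b e ω) = elapse (B.erase b) e.1 ω := by
  unfold afterFirst
  rw [insertMark_self_zero]
  congr 1
  ext1 c
  by_cases h : c = b
  · subst h; simp
  · simp [h, insertMark_of_ne h]

theorem measurable_afterFirst (B : Finset ℤ) (b : ℤ) : Measurable (afterFirst B b) := by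
  refine (measurable_elapse_prod (B.erase b)).comp
    (f := fun ω : Marks => ((ω b 0).1, Function.update ω b fun n => ω b (n + 1))) ?_
  refine Measurable.prodMk (by fun_prop) (measurable_pi_lambda _ fun c => ?_)
  by_cases h : c = b
  · subst h
    simp only [Function.update_self]
    fun_prop
  · simp only [Function.update_of_ne h]
    fun_prop

/-- The first mark in `B` is at the pair `b`. -/
def IsFirst (B : Finset ℤ) (b : ℤ) (ω : Marks) : Prop :=
  ∀ c ∈ B.erase b, (ω b 0).1 < (ω c 0).1

theorem measurableSet_isFirst (B : Finset ℤ) (b : ℤ) : MeasurableSet {ω | IsFirst B b ω} := by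
  have : {ω | IsFirst B b ω} = ⋂ c ∈ B.erase b, {ω : Marks | (ω b 0).1 < (ω c 0).1} := by
    ext ω; simp [IsFirst]
  rw [this]
  exact Finset.measurableSet_biInter _ fun c _ => measurableSet_lt (by fun_prop) (by fun_prop)

/-- The marks process regenerates at the time of the first mark. -/
theorem marksLaw_first_mark (hε : 0 < ε) {B : Finset ℤ} {b : ℤ} (hb : b ∈ B)
    {A : Bool → Set (ℝ × Marks)} (hA : ∀ a, MeasurableSet (A a)) :
    marksLaw ε {ω | IsFirst B b ω ∧ ((ω b 0).1, afterFirst B b ω) ∈ A (ω b 0).2} =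
      ∫⁻ s in Set.Ici 0, ENNReal.ofReal (ε⁻¹ ^ 2 * Real.exp (-(ε⁻¹ ^ 2 * B.card * s))) *
        (2⁻¹ * ∑ a : Bool, marksLaw ε {ω | (s, ω) ∈ A a}) := by
  have := isProbabilityMeasure_markLaw hε
  have := isProbabilityMeasure_marksLaw hε
  have hAm : MeasurableSet {p : Bool × (ℝ × Marks) | p.2 ∈ A p.1} := by
    have : {p : Bool × (ℝ × Marks) | p.2 ∈ A p.1} = ⋃ a : Bool, {a} ×ˢ A a := by
      ext ⟨a, p⟩; simp
    rw [this]
    exact .iUnion fun a => (measurableSet_singleton a).prod (hA a)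
  have hW : MeasurableSet {ω | IsFirst B b ω ∧ ((ω b 0).1, afterFirst B b ω) ∈ A (ω b 0).2} := by
    refine (measurableSet_isFirst B b).inter ?_
    have h1 := measurable_afterFirst B b
    exact (by fun_prop : Measurable fun ω : Marks => ((ω b 0).2, ((ω b 0).1, afterFirst B b ω))) hAm
  rw [← (measurePreserving_insertMark hε b).measure_preimage hW.nullMeasurableSet,
    prod_apply ((measurable_insertMark b) hW), lintegral_markLaw hε]
  · refine setLIntegral_congr_fun measurableSet_Ici fun s hs => ?_
    simp only [Set.mem_Ici] at hs
    have key : ∀ a : Bool, marksLaw ε (Prod.mk (s, a) ⁻¹'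
        ((fun p : (ℝ × Bool) × Marks => insertMark b p.1 p.2) ⁻¹'
          {ω | IsFirst B b ω ∧ ((ω b 0).1, afterFirst B b ω) ∈ A (ω b 0).2})) =
        ENNReal.ofReal (Real.exp (-(ε⁻¹ ^ 2 * s))) ^ (B.erase b).card *
          marksLaw ε {ω | (s, ω) ∈ A a} := by
      intro a
      rw [← marksLaw_inter_preimage_elapse hε (B.erase b) hs (A := {ω | (s, ω) ∈ A a})
        (measurable_prodMk_left (hA a))]
      congr 1
      ext ω
      simp only [Set.mem_preimage, Set.mem_ofPred_eq, afterFirst_insertMark, insertMark_self_zero,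
        Set.mem_inter_iff, IsFirst]
      refine and_congr_left fun _ => forall₂_congr fun c hc => ?_
      rw [insertMark_of_ne (Finset.ne_of_mem_erase hc)]
    simp only [key]
    rw [← Finset.mul_sum, ← mul_assoc, ← mul_assoc, ← mul_assoc, mul_right_comm _ (2⁻¹ : ℝ≥0∞)]
    congr 2
    rw [← ENNReal.ofReal_pow (Real.exp_nonneg _), ← ENNReal.ofReal_mul (by positivity),
      ← Real.exp_nat_mul, mul_assoc, ← Real.exp_add, Finset.card_erase_of_mem hb,
      Nat.cast_sub (Finset.card_pos.2 ⟨b, hb⟩)]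
    congr 3
    push_cast
    ring
  · exact measurable_measure_prodMk_left ((measurable_insertMark b) hW)

/-- The law of the time of the first mark in `B`. -/
theorem marksLaw_forall_le (hε : 0 < ε) (B : Finset ℤ) {t : ℝ} (ht : 0 ≤ t) :
    marksLaw ε {ω | ∀ b ∈ B, t ≤ (ω b 0).1} =
      ENNReal.ofReal (Real.exp (-(ε⁻¹ ^ 2 * B.card * t))) := by
  have := isProbabilityMeasure_markLaw hε
  have := isProbabilityMeasure_seqLaw hε
  have : IsProbabilityMeasure (expMeasure (ε⁻¹ ^ 2)) :=
    isProbabilityMeasure_expMeasure (by positivity)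
  have h1 : markLaw ε {e | t ≤ e.1} = ENNReal.ofReal (Real.exp (-(ε⁻¹ ^ 2 * t))) := by
    have : {e : ℝ × Bool | t ≤ e.1} = Set.Ici t ×ˢ Set.univ := by ext; simp
    rw [markLaw, this, prod_prod, expMeasure_Ici (by positivity) ht,
      measure_univ, mul_one]
  have h2 : seqLaw ε {q | t ≤ (q 0).1} = ENNReal.ofReal (Real.exp (-(ε⁻¹ ^ 2 * t))) := by
    rw [← h1]
    exact (measurePreserving_eval_infinitePi (fun _ : ℕ => markLaw ε) 0).measure_preimage
      (measurableSet_le measurable_const measurable_fst).nullMeasurableSet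
  have h3 := infinitePi_pi (fun _ : ℤ => seqLaw ε) (s := B) (t := fun _ => {q | t ≤ (q 0).1})
    (fun _ _ => measurableSet_le measurable_const (by fun_prop))
  rw [Finset.prod_const, h2, ← ENNReal.ofReal_pow (Real.exp_nonneg _), ← Real.exp_nat_mul] at h3
  have h4 : {ω : Marks | ∀ b ∈ B, t ≤ (ω b 0).1} = Set.pi B fun _ => {q | t ≤ (q 0).1} := by
    ext; simp
  rw [h4]
  refine h3.trans ?_
  congr 2
  ring

end Regeneration

/-! ### Comparison of event probabilities with supersolutions. -/

section Comparison

variable {ι : Type*} (B : Finset ℤ) (F : Set ι) (step : ι → ℤ → Bool → ι)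

/-- The event that the chain which starts from `i` and is driven by the marks in `B` has made `n`
steps by time `t`, or is in `F` at time `t`. -/
def cascade : ℕ → ι → ℝ → Set Marks
  | 0, _, _ => Set.univ
  | n + 1, i, t => {ω | (i ∈ F ∧ ∀ b ∈ B, t ≤ (ω b 0).1) ∨
      ∃ b ∈ B, IsFirst B b ω ∧ (ω b 0).1 ≤ t ∧
        afterFirst B b ω ∈ cascade n (step i b (ω b 0).2) (t - (ω b 0).1)}

theorem measurableSet_cascade (n : ℕ) (i : ι) :
    MeasurableSet {p : ℝ × Marks | p.2 ∈ cascade B F step n i p.1} := by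
  induction n generalizing i with
  | zero => simp [cascade]
  | succ n ih =>
    have h : {p : ℝ × Marks | p.2 ∈ cascade B F step (n + 1) i p.1} =
        ({_p : ℝ × Marks | i ∈ F} ∩ ⋂ b ∈ B, {p | p.1 ≤ (p.2 b 0).1}) ∪
        ⋃ b ∈ B, ⋃ a : Bool, ({p | IsFirst B b p.2} ∩ {p | (p.2 b 0).1 ≤ p.1} ∩
          {p | (p.2 b 0).2 = a} ∩
          {p | afterFirst B b p.2 ∈ cascade B F step n (step i b a) (p.1 - (p.2 b 0).1)}) := by
      ext p
      simp only [cascade, Set.mem_ofPred_eq, Set.mem_union, Set.mem_inter_iff, Set.mem_iInter,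
        Set.mem_iUnion, exists_prop, and_assoc]
      refine or_congr Iff.rfl (exists_congr fun b => and_congr_right fun _ => ?_)
      simp
    rw [h]
    refine .union (.inter (.const _) (Finset.measurableSet_biInter _ fun b _ =>
      measurableSet_le (by fun_prop) (by fun_prop)))
      (Finset.measurableSet_biUnion _ fun b _ => .iUnion fun a => ?_)
    refine (((measurable_snd (measurableSet_isFirst B b)).inter
      (measurableSet_le (by fun_prop) (by fun_prop))).inter ?_).inter ?_
    · exact (by fun_prop : Measurable fun p : ℝ × Marks => (p.2 b 0).2) (measurableSet_singleton a)
    · have h1 := measurable_afterFirst B b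
      exact (by fun_prop : Measurable fun p : ℝ × Marks =>
        (p.1 - (p.2 b 0).1, afterFirst B b p.2)) (ih (step i b a))

variable {B F step} {ε : ℝ}

/-- The renewal inequality, obtained by splitting according to the first mark: either it comes no
earlier than `t`, or the chain restarts from the new state with the remaining time `t - s`. -/
theorem marksLaw_cascade_succ_le (hε : 0 < ε) (n : ℕ) (i : ι) {t : ℝ} (ht : 0 ≤ t) :
    marksLaw ε (cascade B F step (n + 1) i t) ≤
      F.indicator 1 i * ENNReal.ofReal (Real.exp (-(ε⁻¹ ^ 2 * B.card * t))) +
      ∑ b ∈ B, ∫⁻ s in Set.Icc 0 t,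
        ENNReal.ofReal (ε⁻¹ ^ 2 * Real.exp (-(ε⁻¹ ^ 2 * B.card * s))) *
          (2⁻¹ * ∑ a : Bool, marksLaw ε (cascade B F step n (step i b a) (t - s))) := by
  classical
  let A : ℤ → Bool → Set (ℝ × Marks) := fun b a =>
    {p | p.1 ≤ t ∧ p.2 ∈ cascade B F step n (step i b a) (t - p.1)}
  have hA : ∀ b a, MeasurableSet (A b a) := fun b a =>
    (measurableSet_le measurable_fst measurable_const).inter
      ((by fun_prop : Measurable fun p : ℝ × Marks => (t - p.1, p.2))
        (measurableSet_cascade B F step n (step i b a)))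
  have hsub : cascade B F step (n + 1) i t ⊆ (if i ∈ F then {ω | ∀ b ∈ B, t ≤ (ω b 0).1} else ∅) ∪
      ⋃ b ∈ B, {ω | IsFirst B b ω ∧ ((ω b 0).1, afterFirst B b ω) ∈ A b (ω b 0).2} := by
    rintro ω (⟨hi, h⟩ | ⟨b, hb, h1, h2, h3⟩)
    · left; simpa [hi] using h
    · right
      simp only [Set.mem_iUnion]
      exact ⟨b, hb, h1, h2, h3⟩
  refine (measure_mono hsub).trans ((measure_union_le _ _).trans (add_le_add ?_ ?_))
  · by_cases hi : i ∈ F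
    · simp [hi, marksLaw_forall_le hε B ht]
    · simp [hi]
  · refine (measure_biUnion_finset_le _ _).trans (Finset.sum_le_sum fun b hb => ?_)
    rw [marksLaw_first_mark hε hb (hA b), ← lintegral_indicator measurableSet_Ici,
      ← lintegral_indicator measurableSet_Icc]
    refine lintegral_mono fun s => ?_
    by_cases hs : 0 ≤ s
    · by_cases hst : s ≤ t
      · simp [Set.indicator, hs, hst, A]
      · simp [Set.indicator, hs, hst, A]
    · simp [Set.indicator, hs]

/-- A supersolution of the evolution equation of the chain bounds the probabilities of the
events `cascade`. -/
theorem marksLaw_cascade_le (hε : 0 < ε) {T : ℝ} {I : Set ι}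
    (hI : ∀ i ∈ I, ∀ b ∈ B, ∀ a, step i b a ∈ I) {u u' : ℝ → ι → ℝ}
    (hu : ∀ i ∈ I, ∀ t, HasDerivAt (fun t => u t i) (u' t i) t)
    (hu0 : ∀ i ∈ I, ∀ t ∈ Set.Icc 0 T, 0 ≤ u t i)
    (huF : ∀ i ∈ I, i ∈ F → 1 ≤ u 0 i)
    (hsup : ∀ i ∈ I, ∀ t ∈ Set.Icc 0 T,
      ε⁻¹ ^ 2 / 2 * ∑ b ∈ B, ∑ a : Bool, (u t (step i b a) - u t i) ≤ u' t i)
    (n : ℕ) {i : ι} (hi : i ∈ I) {t : ℝ} (ht : t ∈ Set.Icc 0 T) :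
    marksLaw ε (cascade B F step n i t) ≤
      ENNReal.ofReal (u t i + (1 / 2) ^ n * Real.exp (ε⁻¹ ^ 2 * B.card * t)) := by
  have := isProbabilityMeasure_marksLaw hε
  set r : ℝ := ε⁻¹ ^ 2 with hr
  have hr0 : 0 < r := by positivity
  set l : ℝ := r * B.card with hl
  have hl0 : 0 ≤ l := by positivity
  induction n generalizing i t with
  | zero =>
    refine prob_le_one.trans ?_
    rw [← ENNReal.ofReal_one]
    refine ENNReal.ofReal_le_ofReal ?_
    have h1 := hu0 i hi t ht
    have h2 := Real.one_le_exp (mul_nonneg hl0 ht.1)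
    simpa using by linarith
  | succ n ih =>
    -- The added term does not depend on the state, so the generator annihilates it, while its time
    -- derivative is `l` times itself. This surplus allows the halving at each iteration.
    let w : ℕ → ℝ → ι → ℝ := fun n t i => u t i + (1 / 2) ^ n * Real.exp (l * t)
    have hw0 : ∀ n, ∀ i ∈ I, ∀ s ∈ Set.Icc 0 t, 0 ≤ w n (t - s) i := fun n i hi s hs =>
      add_nonneg (hu0 i hi _ ⟨by linarith [hs.2], by linarith [hs.1, ht.2]⟩) (by positivity)
    have hwc : ∀ n, ∀ i ∈ I, Continuous fun s => w n (t - s) i := fun n i hi => by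
      have h1 : Continuous fun s => u s i :=
        continuous_iff_continuousAt.2 fun s => (hu i hi s).continuousAt
      have h2 : Continuous fun s => u (t - s) i := h1.comp (continuous_const.sub continuous_id)
      simp only [w]
      fun_prop
    let φ : ℝ → ℝ := fun s =>
      ∑ b ∈ B, r * Real.exp (-(l * s)) * (2⁻¹ * ∑ a : Bool, w n (t - s) (step i b a))
    have hφc : ∀ b ∈ B, Continuous fun s =>
        r * Real.exp (-(l * s)) * (2⁻¹ * ∑ a : Bool, w n (t - s) (step i b a)) := fun b hb => by
      have h1 : Continuous fun s => ∑ a : Bool, w n (t - s) (step i b a) :=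
        continuous_finsetSum _ fun a _ => hwc n _ (hI i hi b hb a)
      fun_prop
    have hφc' : Continuous φ := continuous_finsetSum _ hφc
    have hφ0 : ∀ b ∈ B, ∀ s ∈ Set.Icc 0 t,
        0 ≤ r * Real.exp (-(l * s)) * (2⁻¹ * ∑ a : Bool, w n (t - s) (step i b a)) :=
      fun b hb s hs => mul_nonneg (by positivity) (mul_nonneg (by positivity)
        (Finset.sum_nonneg fun a _ => hw0 n _ (hI i hi b hb a) s hs))
    -- the integral term
    have hint : ∑ b ∈ B, ∫⁻ s in Set.Icc 0 t, ENNReal.ofReal (r * Real.exp (-(l * s))) *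
          (2⁻¹ * ∑ a : Bool, marksLaw ε (cascade B F step n (step i b a) (t - s))) ≤
        ENNReal.ofReal (∫ s in (0 : ℝ)..t, φ s) := by
      have h1 : ∫ s in (0 : ℝ)..t, φ s = ∑ b ∈ B, ∫ s in Set.Icc 0 t,
          r * Real.exp (-(l * s)) * (2⁻¹ * ∑ a : Bool, w n (t - s) (step i b a)) := by
        rw [intervalIntegral.integral_finsetSum fun b hb => (hφc b hb).intervalIntegrable _ _]
        refine Finset.sum_congr rfl fun b _ => ?_
        rw [intervalIntegral.integral_of_le ht.1, integral_Icc_eq_integral_Ioc]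
      rw [h1, ENNReal.ofReal_sum_of_nonneg fun b hb =>
        setIntegral_nonneg measurableSet_Icc (hφ0 b hb)]
      refine Finset.sum_le_sum fun b hb => ?_
      rw [ofReal_integral_eq_lintegral_ofReal (hφc b hb).integrableOn_Icc
        ((ae_restrict_iff' measurableSet_Icc).2 (.of_forall (hφ0 b hb)))]
      refine setLIntegral_mono' measurableSet_Icc fun s hs => ?_
      rw [ENNReal.ofReal_mul (p := r * Real.exp (-(l * s))) (by positivity),
        ENNReal.ofReal_mul (p := 2⁻¹) (by positivity),
        ENNReal.ofReal_sum_of_nonneg fun a _ => hw0 n _ (hI i hi b hb a) s hs,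
        ENNReal.ofReal_inv_of_pos two_pos, ENNReal.ofReal_ofNat]
      gcongr with a
      exact ih (hI i hi b hb a) ⟨by linarith [hs.2], by linarith [hs.1, ht.2]⟩
    -- integrate the differential inequality
    have hderiv : ∀ s, HasDerivAt (fun s => -(Real.exp (-(l * s)) * w (n + 1) (t - s) i))
        (Real.exp (-(l * s)) * (l * w (n + 1) (t - s) i +
          (u' (t - s) i + l * ((1 / 2) ^ (n + 1) * Real.exp (l * (t - s)))))) s := by
      intro s
      have h1 : HasDerivAt (fun s : ℝ => t - s) (-1) s := by
        simpa using (hasDerivAt_id s).const_sub t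
      have h2 : HasDerivAt (fun s => u (t - s) i) (u' (t - s) i * -1) s :=
        (hu i hi (t - s)).comp s h1
      have h3 : HasDerivAt (fun s : ℝ => Real.exp (l * (t - s)))
          (Real.exp (l * (t - s)) * (l * -1)) s := (h1.const_mul l).exp
      have h4 : HasDerivAt (fun s : ℝ => Real.exp (-(l * s))) (Real.exp (-(l * s)) * (-(l * 1))) s :=
        ((hasDerivAt_id s).const_mul l).neg.exp
      have h5 := (h4.mul (h2.add (h3.const_mul ((1 / 2) ^ (n + 1))))).neg
      refine h5.congr_deriv ?_
      simp only [w, Pi.add_apply]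
      ring
    -- The differential inequality becomes `∫ φ ≤ w (n + 1) t i - exp (-l t) * w (n + 1) 0 i`; the
    -- subtracted boundary term will absorb the event of no mark before `t`.
    have hle := intervalIntegral.integral_le_sub_of_hasDeriv_right_of_le ht.1
      (fun s _ => (hderiv s).continuousAt.continuousWithinAt)
      (fun s _ => (hderiv s).hasDerivWithinAt) hφc'.integrableOn_Icc (fun s hs => by
        have h1 := hsup i hi (t - s) ⟨by linarith [hs.2], by linarith [hs.1, ht.2]⟩
        have e1 : φ s = Real.exp (-(l * s)) * (r / 2 * ∑ b ∈ B, ∑ a : Bool,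
            (u (t - s) (step i b a) - u (t - s) i) + l * u (t - s) i +
            l * ((1 / 2) ^ n * Real.exp (l * (t - s)))) := by
          simp only [φ, w, Fintype.sum_bool]
          have : ∀ b ∈ B, r * Real.exp (-(l * s)) * (2⁻¹ *
              (u (t - s) (step i b true) + (1 / 2) ^ n * Real.exp (l * (t - s)) +
              (u (t - s) (step i b false) + (1 / 2) ^ n * Real.exp (l * (t - s))))) =
              Real.exp (-(l * s)) * (r / 2) * (u (t - s) (step i b true) - u (t - s) i +
                (u (t - s) (step i b false) - u (t - s) i)) +
              Real.exp (-(l * s)) * (r * u (t - s) i +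
                r * ((1 / 2) ^ n * Real.exp (l * (t - s)))) := fun b _ => by ring
          rw [Finset.sum_congr rfl this, Finset.sum_add_distrib, ← Finset.mul_sum,
            Finset.sum_const, nsmul_eq_mul, hl]
          ring
        rw [e1]
        refine mul_le_mul_of_nonneg_left ?_ (Real.exp_nonneg _)
        simp only [w]
        -- The error enters once through `l * w` and once through its own derivative, and `2 * (1 /
        -- 2) ^ (n + 1) = (1 / 2) ^ n`.
        rw [pow_succ]
        linarith)
    simp only [sub_self, mul_zero, neg_zero, Real.exp_zero, one_mul, sub_zero] at hle
    refine (marksLaw_cascade_succ_le hε n i ht.1).trans ((add_le_add le_rfl hint).trans ?_)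
    have hw1 : F.indicator (1 : ι → ℝ≥0∞) i * ENNReal.ofReal (Real.exp (-(l * t))) ≤
        ENNReal.ofReal (Real.exp (-(l * t)) * w (n + 1) 0 i) := by
      have h0 : (0 : ℝ) ∈ Set.Icc 0 T := ⟨le_rfl, ht.1.trans ht.2⟩
      by_cases hiF : i ∈ F
      · simp only [hiF, Set.indicator_of_mem, Pi.one_apply, one_mul]
        refine ENNReal.ofReal_le_ofReal (le_mul_of_one_le_right (Real.exp_nonneg _) ?_)
        have h1 := huF i hi hiF
        have h2 : 0 ≤ (1 / 2 : ℝ) ^ (n + 1) * Real.exp (l * 0) := by positivity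
        simp only [w]
        linarith
      · simp [hiF]
    refine (add_le_add hw1 le_rfl).trans ?_
    rw [← ENNReal.ofReal_add]
    · refine ENNReal.ofReal_le_ofReal ?_
      have : w (n + 1) t i = u t i + (1 / 2) ^ (n + 1) * Real.exp (l * t) := rfl
      rw [← this]
      linarith
    · have := hw0 (n + 1) i hi t ⟨ht.1, le_rfl⟩
      rw [sub_self] at this
      positivity
    · exact intervalIntegral.integral_nonneg ht.1 fun s hs =>
        Finset.sum_nonneg fun b hb => hφ0 b hb s hs

/-- A set that is almost surely contained in all the events `cascade` is bounded by any
supersolution. -/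
theorem marksLaw_real_le_of_subset_cascade (hε : 0 < ε) {T : ℝ} {I : Set ι}
    (hI : ∀ i ∈ I, ∀ b ∈ B, ∀ a, step i b a ∈ I) {u u' : ℝ → ι → ℝ}
    (hu : ∀ i ∈ I, ∀ t, HasDerivAt (fun t => u t i) (u' t i) t)
    (hu0 : ∀ i ∈ I, ∀ t ∈ Set.Icc 0 T, 0 ≤ u t i)
    (huF : ∀ i ∈ I, i ∈ F → 1 ≤ u 0 i)
    (hsup : ∀ i ∈ I, ∀ t ∈ Set.Icc 0 T,
      ε⁻¹ ^ 2 / 2 * ∑ b ∈ B, ∑ a : Bool, (u t (step i b a) - u t i) ≤ u' t i)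
    {i : ι} (hi : i ∈ I) {t : ℝ} (ht : t ∈ Set.Icc 0 T) {A : Set Marks}
    (hA : ∀ᵐ ω ∂(marksLaw ε), ω ∈ A → ∀ n, ω ∈ cascade B F step n i t) :
    (marksLaw ε).real A ≤ u t i := by
  have hlim : Filter.Tendsto (fun n : ℕ =>
      u t i + (1 / 2) ^ n * Real.exp (ε⁻¹ ^ 2 * B.card * t)) Filter.atTop (nhds (u t i)) := by
    have := ((tendsto_pow_atTop_nhds_zero_of_lt_one (r := (1 / 2 : ℝ)) (by norm_num)
      (by norm_num)).mul_const (Real.exp (ε⁻¹ ^ 2 * B.card * t))).const_add (u t i)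
    simpa using this
  refine ge_of_tendsto hlim (.of_forall fun n => ?_)
  refine ENNReal.toReal_le_of_le_ofReal (add_nonneg (hu0 i hi t ht) (by positivity)) ?_
  refine (measure_mono_ae ?_).trans (marksLaw_cascade_le hε hI hu hu0 huF hsup n hi ht)
  filter_upwards [hA] with ω hω h using hω h n

end Comparison

/-! ### Pathwise decomposition of the particle motion at the first mark. -/

section Paths

/-- The waiting times at the pairs in `B` are positive, the marks do not accumulate, and no two
marks appear simultaneously. -/
structure Regular (B : Finset ℤ) (ω : Marks) : Prop where
  pos : ∀ b ∈ B, ∀ n, 0 < (ω b n).1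
  unbounded : ∀ b ∈ B, ∀ K : ℝ, ∃ n, K < markTime ω b n
  ne : ∀ b ∈ B, ∀ c ∈ B, b ≠ c → ∀ m n, markTime ω b m ≠ markTime ω c n

theorem markTime_zero (ω : Marks) (b : ℤ) : markTime ω b 0 = (ω b 0).1 := by
  simp [markTime]

theorem markTime_succ (ω : Marks) (b : ℤ) (n : ℕ) :
    markTime ω b (n + 1) = markTime ω b n + (ω b (n + 1)).1 :=
  Finset.sum_range_succ _ _

theorem afterFirst_self (B : Finset ℤ) (b : ℤ) (ω : Marks) (n : ℕ) :
    afterFirst B b ω b n = ω b (n + 1) := by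
  simp [afterFirst, elapse]

theorem afterFirst_zero_of_ne {B : Finset ℤ} {b c : ℤ} (ω : Marks) (hc : c ∈ B) (h : c ≠ b) :
    afterFirst B b ω c 0 = ((ω c 0).1 - (ω b 0).1, (ω c 0).2) := by
  simp [afterFirst, elapse, shiftHead, hc, h]

theorem afterFirst_succ_of_ne {B : Finset ℤ} {b c : ℤ} (ω : Marks) (h : c ≠ b) (n : ℕ) :
    afterFirst B b ω c (n + 1) = ω c (n + 1) := by
  by_cases hc : c ∈ B <;> simp [afterFirst, elapse, shiftHead, h, hc]

theorem markTime_afterFirst_self (B : Finset ℤ) (b : ℤ) (ω : Marks) (n : ℕ) :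
    markTime (afterFirst B b ω) b n = markTime ω b (n + 1) - (ω b 0).1 := by
  unfold markTime
  rw [Finset.sum_range_succ' (fun i => (ω b i).1) (n + 1)]
  simp [afterFirst_self]

theorem markTime_afterFirst_of_ne {B : Finset ℤ} {b c : ℤ} (ω : Marks) (hc : c ∈ B) (h : c ≠ b)
    (n : ℕ) : markTime (afterFirst B b ω) c n = markTime ω c n - (ω b 0).1 := by
  unfold markTime
  rw [Finset.sum_range_succ' (fun i => (ω c i).1) n, Finset.sum_range_succ']
  simp only [afterFirst_succ_of_ne ω h, afterFirst_zero_of_ne ω hc h]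
  ring

theorem Regular.strictMono {B : Finset ℤ} {ω : Marks} (hg : Regular B ω) {b : ℤ} (hb : b ∈ B) :
    StrictMono (markTime ω b) :=
  strictMono_nat_of_lt_succ fun n => by
    rw [markTime_succ]; linarith [hg.pos b hb (n + 1)]

theorem Regular.markTime_pos {B : Finset ℤ} {ω : Marks} (hg : Regular B ω) {b : ℤ} (hb : b ∈ B)
    (n : ℕ) : 0 < markTime ω b n :=
  (markTime_zero ω b ▸ hg.pos b hb 0 : 0 < markTime ω b 0).trans_le
    ((hg.strictMono hb).monotone n.zero_le)

theorem Regular.exists_isFirst {B : Finset ℤ} {ω : Marks} (hg : Regular B ω) (hB : B.Nonempty) :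
    ∃ b ∈ B, IsFirst B b ω := by
  obtain ⟨b, hb, h⟩ := B.exists_min_image (fun b => (ω b 0).1) hB
  refine ⟨b, hb, fun c hc => ?_⟩
  rw [Finset.mem_erase] at hc
  refine lt_of_le_of_ne (h c hc.2) fun he => ?_
  exact hg.ne b hb c hc.2 hc.1.symm 0 0 (by rwa [markTime_zero, markTime_zero])

theorem Regular.afterFirst {B : Finset ℤ} {ω : Marks} (hg : Regular B ω) {b : ℤ} (hb : b ∈ B)
    (hf : IsFirst B b ω) : Regular B (afterFirst B b ω) where
  pos c hc n := by
    by_cases h : c = b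
    · subst h
      rw [afterFirst_self]
      exact hg.pos c hc _
    · cases n with
      | zero =>
        rw [afterFirst_zero_of_ne ω hc h]
        exact sub_pos.2 (hf c (Finset.mem_erase.2 ⟨h, hc⟩))
      | succ n =>
        rw [afterFirst_succ_of_ne ω h]
        exact hg.pos c hc _
  unbounded c hc K := by
    obtain ⟨n, hn⟩ := hg.unbounded c hc (K + (ω b 0).1)
    refine ⟨n, ?_⟩
    by_cases h : c = b
    · subst h
      rw [markTime_afterFirst_self, markTime_succ]
      linarith [hg.pos c hc (n + 1)]
    · rw [markTime_afterFirst_of_ne ω hc h]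
      linarith
  ne c hc d hd hcd m n := by
    have key : ∀ e ∈ B, ∀ n, ∃ k,
        markTime (Stirring.afterFirst B b ω) e n = markTime ω e k - (ω b 0).1 := by
      intro e he n
      by_cases h : e = b
      · subst h
        exact ⟨n + 1, markTime_afterFirst_self _ _ _ _⟩
      · exact ⟨n, markTime_afterFirst_of_ne ω he h n⟩
    obtain ⟨k, hk⟩ := key c hc m
    obtain ⟨l, hl⟩ := key d hd n
    rw [hk, hl]
    exact fun he => hg.ne c hc d hd hcd k l (by linarith)

theorem Regular.first_le_markTime {B : Finset ℤ} {ω : Marks} (hg : Regular B ω) {b : ℤ}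
    (hf : IsFirst B b ω) {c : ℤ} (hc : c ∈ B) (n : ℕ) : (ω b 0).1 ≤ markTime ω c n := by
  refine le_trans ?_ ((hg.strictMono hc).monotone n.zero_le)
  rw [markTime_zero]
  by_cases h : c = b
  · rw [h]
  · exact (hf c (Finset.mem_erase.2 ⟨h, hc⟩)).le

theorem Regular.markTime_eq_first_iff {B : Finset ℤ} {ω : Marks} (hg : Regular B ω) {b : ℤ}
    (hb : b ∈ B) {c : ℤ} (hc : c ∈ B) (n : ℕ) :
    markTime ω c n = (ω b 0).1 ↔ c = b ∧ n = 0 := by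
  constructor
  · intro h
    rw [← markTime_zero] at h
    have hcb : c = b := by
      by_contra hne
      exact hg.ne c hc b hb hne n 0 h
    subst hcb
    exact ⟨rfl, (hg.strictMono hc).injective h⟩
  · rintro ⟨rfl, rfl⟩
    exact markTime_zero ω c

/-- Marks correspond under a time shift. The condition `0 < s` is needed since the first mark, which
would sit at `0`, has been removed. The predicate `P` treats all marks and active marks together. -/
theorem exists_mark_afterFirst_iff {B : Finset ℤ} {ω : Marks} {b : ℤ} (P : Bool → Prop)
    {c : ℤ} (hc : c ∈ B) {s : ℝ} (hs : 0 < s) :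
    (∃ n, markTime (Stirring.afterFirst B b ω) c n = s ∧ P (Stirring.afterFirst B b ω c n).2) ↔
      ∃ n, markTime ω c n = (ω b 0).1 + s ∧ P (ω c n).2 := by
  by_cases h : c = b
  · subst h
    constructor
    · rintro ⟨n, h1, h2⟩
      rw [markTime_afterFirst_self] at h1
      rw [afterFirst_self] at h2
      exact ⟨n + 1, by linarith, h2⟩
    · rintro ⟨n, h1, h2⟩
      cases n with
      | zero => rw [markTime_zero] at h1; linarith
      | succ n =>
        refine ⟨n, ?_, ?_⟩
        · rw [markTime_afterFirst_self]; linarith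
        · rwa [afterFirst_self]
  · have e : ∀ n, (Stirring.afterFirst B b ω c n).2 = (ω c n).2 := by
      intro n
      cases n with
      | zero => rw [afterFirst_zero_of_ne ω hc h]
      | succ n => rw [afterFirst_succ_of_ne ω h]
    refine exists_congr fun n => ?_
    rw [e, markTime_afterFirst_of_ne ω hc h, sub_eq_iff_eq_add']

theorem isMark_afterFirst_iff {B : Finset ℤ} {ω : Marks} {b c : ℤ} (hc : c ∈ B) {s : ℝ}
    (hs : 0 < s) :
    IsMark (Stirring.afterFirst B b ω) c s ↔ IsMark ω c ((ω b 0).1 + s) := by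
  simpa [IsMark] using exists_mark_afterFirst_iff (fun _ => True) hc hs

theorem isActiveMark_afterFirst_iff {B : Finset ℤ} {ω : Marks} {b c : ℤ} (hc : c ∈ B) {s : ℝ}
    (hs : 0 < s) :
    IsActiveMark (Stirring.afterFirst B b ω) c s ↔ IsActiveMark ω c ((ω b 0).1 + s) :=
  exists_mark_afterFirst_iff (fun a => a = true) hc hs

/-- Effect of a mark with attribute `a` at the pair `{b, b + 1}` on a particle at `x`. -/
def exchange (b : ℤ) (a : Bool) (x : ℤ) : ℤ :=
  if a = true ∧ x = b then b + 1 else if a = true ∧ x = b + 1 then b else x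

theorem mem_bonds {N : ℕ} {b : ℤ} : b ∈ bonds N ↔ -(N : ℤ) ≤ b ∧ b + 1 ≤ N := by
  simp only [bonds, box, Finset.mem_filter, Finset.mem_Icc]
  omega

theorem mem_box {N : ℕ} {x : ℤ} : x ∈ box N ↔ -(N : ℤ) ≤ x ∧ x ≤ N := by
  simp [box]

theorem exchange_mem_box {N : ℕ} {b : ℤ} (hb : b ∈ bonds N) (a : Bool) {x : ℤ} (hx : x ∈ box N) :
    exchange b a x ∈ box N := by
  rw [mem_bonds] at hb
  rw [mem_box] at hx ⊢
  unfold exchange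
  split_ifs <;> omega

theorem exchange_ne {b : ℤ} (a : Bool) {x y : ℤ} (h : x ≠ y) : exchange b a x ≠ exchange b a y := by
  cases a
  · simpa [exchange] using h
  · simp only [exchange, true_and]
    split_ifs <;> omega

section Box

variable {N : ℕ} {ω : Marks} {b : ℤ}

theorem Regular.pos_of_mem_markTimes (hg : Regular (bonds N) ω) {s : ℝ} (hs : s ∈ markTimes N ω) :
    0 < s := by
  obtain ⟨c, hc, n, rfl⟩ := hs
  exact hg.markTime_pos hc n

theorem mem_markTimes_afterFirst {s : ℝ} (hs : 0 < s) :
    s ∈ markTimes N (Stirring.afterFirst (bonds N) b ω) ↔ (ω b 0).1 + s ∈ markTimes N ω :=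
  exists_congr fun _ => and_congr_right fun hc => isMark_afterFirst_iff hc hs

theorem first_mem_markTimes (hb : b ∈ bonds N) : (ω b 0).1 ∈ markTimes N ω :=
  ⟨b, hb, 0, markTime_zero ω b⟩

theorem Regular.first_le (hg : Regular (bonds N) ω) (hf : IsFirst (bonds N) b ω) {s : ℝ}
    (hs : s ∈ markTimes N ω) : (ω b 0).1 ≤ s := by
  obtain ⟨c, hc, n, rfl⟩ := hs
  exact hg.first_le_markTime hf hc n

theorem Regular.move_first (hg : Regular (bonds N) ω) (hb : b ∈ bonds N) (x : ℤ) :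
    move N ω (ω b 0).1 x = exchange b (ω b 0).2 x := by
  have key : ∀ c ∈ bonds N, IsActiveMark ω c (ω b 0).1 ↔ (ω b 0).2 = true ∧ c = b := by
    intro c hc
    constructor
    · rintro ⟨n, h1, h2⟩
      obtain ⟨rfl, rfl⟩ := (hg.markTime_eq_first_iff hb hc n).1 h1
      exact ⟨h2, rfl⟩
    · rintro ⟨h, rfl⟩
      exact ⟨0, markTime_zero ω c, h⟩
  have k1 : ∀ c, c ∈ bonds N ∧ IsActiveMark ω c (ω b 0).1 ↔ (ω b 0).2 = true ∧ c = b := by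
    intro c
    constructor
    · rintro ⟨h1, h2⟩
      exact (key c h1).1 h2
    · rintro ⟨h1, rfl⟩
      exact ⟨hb, (key c hb).2 ⟨h1, rfl⟩⟩
  unfold move exchange
  simp only [k1]
  by_cases h1 : (ω b 0).2 = true ∧ x = b
  · simp [h1]
  · rw [if_neg h1, if_neg h1]
    by_cases h2 : (ω b 0).2 = true ∧ x - 1 = b
    · rw [if_pos h2, if_pos ⟨h2.1, by omega⟩]; omega
    · rw [if_neg h2, if_neg fun h => h2 ⟨h.1, by omega⟩]

theorem move_afterFirst {s : ℝ} (hs : 0 < s)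
    (x : ℤ) :
    move N (Stirring.afterFirst (bonds N) b ω) s x = move N ω ((ω b 0).1 + s) x := by
  have k : ∀ c, (c ∈ bonds N ∧ IsActiveMark (Stirring.afterFirst (bonds N) b ω) c s) ↔
      (c ∈ bonds N ∧ IsActiveMark ω c ((ω b 0).1 + s)) := fun c =>
    and_congr_right fun hc => isActiveMark_afterFirst_iff hc hs
  unfold move
  by_cases h1 : x ∈ bonds N ∧ IsActiveMark ω x ((ω b 0).1 + s)
  · rw [if_pos h1, if_pos ((k x).2 h1)]
  · rw [if_neg h1, if_neg (mt (k x).1 h1)]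
    by_cases h2 : x - 1 ∈ bonds N ∧ IsActiveMark ω (x - 1) ((ω b 0).1 + s)
    · rw [if_pos h2, if_pos ((k (x - 1)).2 h2)]
    · rw [if_neg h2, if_neg (mt (k (x - 1)).1 h2)]

theorem Regular.exists_markTime_gt (hg : Regular (bonds N) ω) (hb : b ∈ bonds N) (K : ℝ) :
    {s | s ∈ markTimes N ω ∧ K < s}.Nonempty := by
  obtain ⟨n, hn⟩ := hg.unbounded b hb K
  exact ⟨_, ⟨b, hb, n, rfl⟩, hn⟩

theorem Regular.finite_markTimes (hg : Regular (bonds N) ω) (t : ℝ) :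
    {s | s ∈ markTimes N ω ∧ 0 < s ∧ s ≤ t}.Finite := by
  have : ∀ c ∈ bonds N, (markTime ω c '' {n | markTime ω c n ≤ t}).Finite := by
    intro c hc
    refine Set.Finite.image _ ?_
    obtain ⟨n, hn⟩ := hg.unbounded c hc t
    refine (Set.finite_Iio n).subset fun k hk => ?_
    by_contra hkn
    have : markTime ω c n ≤ markTime ω c k := (hg.strictMono hc).monotone (not_lt.1 hkn)
    exact absurd (hn.trans_le this) (not_lt.2 hk)
  refine ((bonds N).finite_toSet.biUnion this).subset ?_
  rintro s ⟨⟨c, hc, n, rfl⟩, _, hst⟩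
  exact Set.mem_biUnion hc ⟨n, hst, rfl⟩

/-- The infimum in the definition of `epoch` is a minimum. -/
theorem Regular.epoch_succ_mem (hg : Regular (bonds N) ω) (hb : b ∈ bonds N) (n : ℕ)
    (h0 : 0 ≤ epoch N ω n) :
    epoch N ω (n + 1) ∈ {s | s ∈ markTimes N ω ∧ epoch N ω n < s} := by
  obtain ⟨s₀, h1, h2⟩ := hg.exists_markTime_gt hb (epoch N ω n)
  have hfin : {s | (s ∈ markTimes N ω ∧ epoch N ω n < s) ∧ s ≤ s₀}.Finite :=
    (hg.finite_markTimes s₀).subset fun s hs => ⟨hs.1.1, h0.trans_lt hs.1.2, hs.2⟩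
  obtain ⟨m, ⟨hm1, hm2⟩, hmin⟩ := hfin.exists_minimal ⟨s₀, ⟨h1, h2⟩, le_rfl⟩
  have hleast : IsLeast {s | s ∈ markTimes N ω ∧ epoch N ω n < s} m := by
    refine ⟨hm1, fun s hs => ?_⟩
    rcases le_total s s₀ with h | h
    · rcases le_total m s with h' | h'
      · exact h'
      · exact hmin ⟨hs, h⟩ h'
    · exact hm2.trans h
  have : epoch N ω (n + 1) = m := hleast.csInf_eq
  rw [this]
  exact hm1

theorem Regular.epoch_nonneg (hg : Regular (bonds N) ω) (hb : b ∈ bonds N) (n : ℕ) :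
    0 ≤ epoch N ω n := by
  induction n with
  | zero => exact le_rfl
  | succ n ih => exact ih.trans (hg.epoch_succ_mem hb n ih).2.le

theorem Regular.epoch_succ (hg : Regular (bonds N) ω) (hb : b ∈ bonds N)
    (hf : IsFirst (bonds N) b ω) (n : ℕ) :
    epoch N ω (n + 1) = (ω b 0).1 + epoch N (Stirring.afterFirst (bonds N) b ω) n := by
  have hg' := hg.afterFirst hb hf
  induction n with
  | zero =>
    have : IsLeast {s | s ∈ markTimes N ω ∧ epoch N ω 0 < s} (ω b 0).1 :=
      ⟨⟨first_mem_markTimes hb, hg.pos b hb 0⟩, fun s hs => hg.first_le hf hs.1⟩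
    rw [show epoch N ω (0 + 1) = (ω b 0).1 from this.csInf_eq]
    simp [epoch]
  | succ n ih =>
    have h0 := hg'.epoch_nonneg hb n
    have hm := hg'.epoch_succ_mem hb n h0
    refine IsLeast.csInf_eq ⟨⟨?_, ?_⟩, fun s hs => ?_⟩
    · exact (mem_markTimes_afterFirst (h0.trans_lt hm.2)).1 hm.1
    · rw [ih]; linarith [hm.2]
    · have hs2 := hs.2
      rw [ih] at hs2
      have hpos : 0 < s - (ω b 0).1 := by linarith
      have : epoch N (Stirring.afterFirst (bonds N) b ω) (n + 1) ≤ s - (ω b 0).1 := by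
        refine csInf_le ⟨0, fun x hx => h0.trans hx.2.le⟩ ⟨?_, by linarith⟩
        rw [mem_markTimes_afterFirst hpos, add_sub_cancel]
        exact hs.1
      linarith

theorem Regular.skeleton_succ (hg : Regular (bonds N) ω) (hb : b ∈ bonds N)
    (hf : IsFirst (bonds N) b ω) (x : ℤ) (n : ℕ) :
    skeleton N ω x (n + 1) =
      skeleton N (Stirring.afterFirst (bonds N) b ω) (exchange b (ω b 0).2 x) n := by
  have hg' := hg.afterFirst hb hf
  induction n with
  | zero =>
    simp only [skeleton]
    rw [hg.epoch_succ hb hf]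
    simp only [epoch, add_zero]
    exact hg.move_first hb x
  | succ n ih =>
    have hpos : 0 < epoch N (Stirring.afterFirst (bonds N) b ω) (n + 1) :=
      hg'.pos_of_mem_markTimes (hg'.epoch_succ_mem hb n (hg'.epoch_nonneg hb n)).1
    rw [skeleton, ih, hg.epoch_succ hb hf, skeleton, move_afterFirst hpos]

theorem Regular.position_of_lt (hg : Regular (bonds N) ω) (hf : IsFirst (bonds N) b ω) (x : ℤ)
    {s : ℝ} (hs : s < (ω b 0).1) : position N ω x s = x := by
  have : {u | u ∈ markTimes N ω ∧ 0 < u ∧ u ≤ s} = ∅ := by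
    ext u
    simp only [Set.mem_ofPred_eq, Set.mem_empty_iff_false, iff_false]
    rintro ⟨h1, _, h2⟩
    exact absurd (hg.first_le hf h1) (by linarith)
  rw [position, this, Set.ncard_empty, skeleton]

/-- Positions are indexed by the number of mark times up to `s`; the shifted process has exactly one
mark time fewer, and `Regular.skeleton_succ` absorbs that one step. -/
theorem Regular.position_add (hg : Regular (bonds N) ω) (hb : b ∈ bonds N)
    (hf : IsFirst (bonds N) b ω) (x : ℤ) {s : ℝ} (hs : 0 ≤ s) :
    position N ω x ((ω b 0).1 + s) =
      position N (Stirring.afterFirst (bonds N) b ω) (exchange b (ω b 0).2 x) s := by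
  have hg' := hg.afterFirst hb hf
  have hset : {u | u ∈ markTimes N ω ∧ 0 < u ∧ u ≤ (ω b 0).1 + s} = insert (ω b 0).1
      ((fun v => (ω b 0).1 + v) ''
        {v | v ∈ markTimes N (Stirring.afterFirst (bonds N) b ω) ∧ 0 < v ∧ v ≤ s}) := by
    ext u
    simp only [Set.mem_ofPred_eq, Set.mem_insert_iff, Set.mem_image]
    constructor
    · rintro ⟨h1, h2, h3⟩
      rcases (hg.first_le hf h1).eq_or_lt with h | h
      · exact Or.inl h.symm
      · refine Or.inr ⟨u - (ω b 0).1, ⟨?_, by linarith, by linarith⟩, by ring⟩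
        rw [mem_markTimes_afterFirst (by linarith), add_sub_cancel]
        exact h1
    · rintro (rfl | ⟨v, ⟨h1, h2, h3⟩, rfl⟩)
      · exact ⟨first_mem_markTimes hb, hg.pos b hb 0, by linarith⟩
      · exact ⟨(mem_markTimes_afterFirst h2).1 h1, by linarith [hg.pos b hb 0], by linarith⟩
  rw [position, hset, Set.ncard_insert_of_notMem _ ((hg'.finite_markTimes s).image _),
    Set.ncard_image_of_injective _ (add_right_injective _), hg.skeleton_succ hb hf, position]
  · rintro ⟨v, ⟨_, h2, _⟩, h3⟩
    simp only at h3
    linarith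

theorem position_mem_box (ω : Marks) {x : ℤ} (hx : x ∈ box N) (s : ℝ) :
    position N ω x s ∈ box N := by
  unfold position
  generalize Set.ncard _ = n
  induction n with
  | zero => exact hx
  | succ n ih =>
    rw [skeleton]
    generalize skeleton N ω x n = y at ih
    unfold move
    rw [mem_box] at ih
    split_ifs with h1 h2
    · have := mem_bonds.1 h1.1; rw [mem_box]; omega
    · have := mem_bonds.1 h2.1; rw [mem_box]; omega
    · rwa [mem_box]

/-- Particles never leave the box, so neighbouring particles span a pair contained in it. Contact
marks can thus be handled through the marks in `bonds N` alone, where regularity is available. -/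
theorem mem_markTimes_of_mem_contactMarks {x y : ℤ} (hx : x ∈ box N) (hy : y ∈ box N)
    {p : ℝ × ℤ × ℤ} (hp : p ∈ contactMarks N x y ω) :
    min p.2.1 p.2.2 ∈ bonds N ∧ p.1 ∈ markTimes N ω := by
  obtain ⟨⟨_, h1⟩, h2, h3, h4⟩ := hp
  have hx' := mem_box.1 (position_mem_box ω hx p.1)
  have hy' := mem_box.1 (position_mem_box ω hy p.1)
  rw [← h2] at hx' h1
  rw [← h3] at hy' h1
  have : min p.2.1 p.2.2 ∈ bonds N := by
    rw [mem_bonds]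
    rcases abs_eq (zero_le_one) |>.1 h1 with h | h <;> omega
  exact ⟨this, _, this, h4⟩

theorem Regular.add_mem_contactMarks_iff (hg : Regular (bonds N) ω) (hb : b ∈ bonds N)
    (hf : IsFirst (bonds N) b ω) {x y : ℤ} (hx : x ∈ box N) (hy : y ∈ box N) {s : ℝ} (hs : 0 < s)
    (z : ℤ × ℤ) :
    ((ω b 0).1 + s, z) ∈ contactMarks N x y ω ↔
      (s, z) ∈ contactMarks N (exchange b (ω b 0).2 x) (exchange b (ω b 0).2 y)
        (Stirring.afterFirst (bonds N) b ω) := by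
  have e : ((ω b 0).1 + s, z) ∈ contactMarks N x y ω ∧ min z.1 z.2 ∈ bonds N ↔
      (s, z) ∈ contactMarks N (exchange b (ω b 0).2 x) (exchange b (ω b 0).2 y)
        (Stirring.afterFirst (bonds N) b ω) ∧ min z.1 z.2 ∈ bonds N := by
    refine and_congr_left fun hz => ?_
    have h0 : 0 ≤ (ω b 0).1 + s := by linarith [hg.pos b hb 0]
    simp only [contactMarks, contactTimes, Set.mem_ofPred_eq, hg.position_add hb hf _ hs.le, h0,
      hs.le, true_and, isMark_afterFirst_iff hz hs]
  constructor
  · intro h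
    exact (e.1 ⟨h, (mem_markTimes_of_mem_contactMarks hx hy h).1⟩).1
  · intro h
    exact (e.2 ⟨h, (mem_markTimes_of_mem_contactMarks (exchange_mem_box hb _ hx)
      (exchange_mem_box hb _ hy) h).1⟩).1

/-- The particles at `x` and `y` occupy the two sites of the pair `b`. -/
def Touch (b x y : ℤ) : Prop := (x = b ∧ y = b + 1) ∨ (x = b + 1 ∧ y = b)

instance (b x y : ℤ) : Decidable (Touch b x y) := by unfold Touch; infer_instance

theorem Regular.first_mem_contactMarks_iff (hg : Regular (bonds N) ω) (hb : b ∈ bonds N)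
    (hf : IsFirst (bonds N) b ω) {x y : ℤ} (hx : x ∈ box N) (hy : y ∈ box N) (z : ℤ × ℤ) :
    ((ω b 0).1, z) ∈ contactMarks N x y ω ↔
      Touch b x y ∧ z = (exchange b (ω b 0).2 x, exchange b (ω b 0).2 y) := by
  have hg' := hg.afterFirst hb hf
  -- By right continuity the position at the first mark time is the one just after the move.
  have hpos : ∀ w, position N ω w (ω b 0).1 = exchange b (ω b 0).2 w := by
    intro w
    have h1 := hg.position_add hb hf w le_rfl
    rw [add_zero] at h1
    rw [h1]
    obtain ⟨c, hc, hc'⟩ := hg'.exists_isFirst ⟨b, hb⟩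
    exact hg'.position_of_lt hc' _ (hg'.pos c hc 0)
  have hmark : ∀ c ∈ bonds N, IsMark ω c (ω b 0).1 ↔ c = b := by
    intro c hc
    constructor
    · rintro ⟨n, hn⟩
      exact ((hg.markTime_eq_first_iff hb hc n).1 hn).1
    · rintro rfl
      exact ⟨0, markTime_zero ω c⟩
  -- Contact is tested after the move and `Touch` before it; they agree because a mark at `b` only
  -- permutes the sites `b` and `b + 1`.
  have htouch : (|exchange b (ω b 0).2 x - exchange b (ω b 0).2 y| = 1 ∧
      min (exchange b (ω b 0).2 x) (exchange b (ω b 0).2 y) = b) ↔ Touch b x y := by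
    rw [abs_eq zero_le_one]
    unfold Touch
    generalize (ω b 0).2 = a
    cases a
    · simp only [exchange, Bool.false_eq_true, false_and, if_false]
      omega
    · simp only [exchange, true_and]
      split_ifs <;> omega
  constructor
  · intro h
    have hm := (mem_markTimes_of_mem_contactMarks hx hy h).1
    obtain ⟨⟨_, h1⟩, h2, h3, h4⟩ := h
    simp only [hpos] at h1 h2 h3 h4 hm
    rw [h2, h3] at h4 hm
    exact ⟨htouch.1 ⟨h1, (hmark _ hm).1 h4⟩, Prod.ext h2 h3⟩
  · rintro ⟨h, rfl⟩
    obtain ⟨h1, h2⟩ := htouch.2 h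
    refine ⟨⟨(hg.pos b hb 0).le, ?_⟩, ?_, ?_, ?_⟩ <;> simp only [hpos]
    · exact h1
    · rw [h2]
      exact (hmark b hb).2 rfl

end Box

end Paths

/-! ### Almost sure regularity of the marks. -/

section AlmostSure

variable {ε : ℝ}

theorem ae_wait_pos (hε : 0 < ε) (b : ℤ) (n : ℕ) : ∀ᵐ ω ∂(marksLaw ε), 0 < (ω b n).1 := by
  have := isProbabilityMeasure_markLaw hε
  have := isProbabilityMeasure_seqLaw hε
  have hr : IsProbabilityMeasure (expMeasure (ε⁻¹ ^ 2)) :=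
    isProbabilityMeasure_expMeasure (by positivity)
  have h1 : ∀ᵐ x ∂(expMeasure (ε⁻¹ ^ 2)), 0 < x := by
    have := expMeasure_Ioi (r := ε⁻¹ ^ 2) (by positivity) le_rfl
    rw [mul_zero, neg_zero, Real.exp_zero, ENNReal.ofReal_one] at this
    exact (prob_compl_eq_zero_iff measurableSet_Ioi).2 this
  have h2 : ∀ᵐ e ∂(markLaw ε), 0 < e.1 := measurePreserving_fst.quasiMeasurePreserving.ae h1
  have h3 : ∀ᵐ q ∂(seqLaw ε), 0 < (q n).1 :=
    (measurePreserving_eval_infinitePi (fun _ : ℕ => markLaw ε) n).quasiMeasurePreserving.ae h2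
  exact (measurePreserving_eval_infinitePi (fun _ : ℤ => seqLaw ε) b).quasiMeasurePreserving.ae h3

theorem seqLaw_forall_wait_le (hε : 0 < ε) {K : ℝ} (hK : 0 ≤ K) :
    seqLaw ε {q | ∀ n, (q n).1 ≤ K} = 0 := by
  have := isProbabilityMeasure_markLaw hε
  have : IsProbabilityMeasure (expMeasure (ε⁻¹ ^ 2)) :=
    isProbabilityMeasure_expMeasure (by positivity)
  set p := markLaw ε {e | e.1 ≤ K} with hp
  have hp1 : p < 1 := by
    have e1 : {e : ℝ × Bool | e.1 ≤ K} = (Set.Ioi K)ᶜ ×ˢ Set.univ := by ext; simp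
    rw [hp, e1, markLaw, prod_prod, measure_univ, mul_one, prob_compl_eq_one_sub measurableSet_Ioi,
      expMeasure_Ioi (by positivity) hK]
    exact ENNReal.sub_lt_self ENNReal.one_ne_top one_ne_zero (by simpa using Real.exp_pos _)
  have hle : ∀ n, seqLaw ε {q | ∀ n, (q n).1 ≤ K} ≤ p ^ n := by
    intro n
    have h := infinitePi_pi (fun _ : ℕ => markLaw ε) (s := Finset.range n)
      (t := fun _ => {e | e.1 ≤ K}) (fun _ _ => measurableSet_le measurable_fst measurable_const)
    rw [Finset.prod_const, Finset.card_range, ← hp] at h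
    rw [← h]
    exact measure_mono fun q hq i _ => hq i
  exact le_antisymm (ge_of_tendsto' (ENNReal.tendsto_pow_atTop_nhds_zero_of_lt_one hp1) hle)
    bot_le

theorem ae_markTime_unbounded (hε : 0 < ε) (b : ℤ) :
    ∀ᵐ ω ∂(marksLaw ε), ∀ K : ℝ, ∃ n, K < markTime ω b n := by
  have := isProbabilityMeasure_seqLaw hε
  have h1 : ∀ K : ℕ, ∀ᵐ ω ∂(marksLaw ε), ∃ n, (K : ℝ) < (ω b n).1 := by
    intro K
    have h : ∀ᵐ q ∂(seqLaw ε), ∃ n, (K : ℝ) < (q n).1 := by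
      have := seqLaw_forall_wait_le hε (Nat.cast_nonneg K : (0 : ℝ) ≤ K)
      rw [ae_iff]
      simpa using this
    exact (measurePreserving_eval_infinitePi (fun _ : ℤ => seqLaw ε) b).quasiMeasurePreserving.ae h
  filter_upwards [ae_all_iff.2 h1, ae_all_iff.2 (ae_wait_pos hε b)] with ω hω hpos K
  obtain ⟨k, hk⟩ := exists_nat_gt K
  obtain ⟨n, hn⟩ := hω k
  refine ⟨n, hk.trans (hn.trans_le ?_)⟩
  exact Finset.single_le_sum (f := fun i => (ω b i).1) (fun i _ => (hpos i).le)
    (Finset.self_mem_range_succ n)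

/-- Given all other waiting times, a coincidence forces the first waiting time at `b` to take one
prescribed value, and the exponential law has no atoms. -/
theorem ae_markTime_ne (hε : 0 < ε) {b c : ℤ} (hbc : b ≠ c) (m n : ℕ) :
    ∀ᵐ ω ∂(marksLaw ε), markTime ω b m ≠ markTime ω c n := by
  have := isProbabilityMeasure_markLaw hε
  have := isProbabilityMeasure_marksLaw hε
  have : IsProbabilityMeasure (expMeasure (ε⁻¹ ^ 2)) :=
    isProbabilityMeasure_expMeasure (by positivity)
  have hm : ∀ d k, Measurable fun ω : Marks => markTime ω d k := fun d k => by
    unfold markTime; fun_prop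
  have hW : MeasurableSet {ω : Marks | markTime ω b m = markTime ω c n} :=
    measurableSet_eq_fun (hm b m) (hm c n)
  have hatom : ∀ x, markLaw ε {e | e.1 = x} = 0 := fun x => by
    have e1 : {e : ℝ × Bool | e.1 = x} = {x} ×ˢ Set.univ := by ext; simp
    rw [e1, markLaw, prod_prod, measure_singleton, zero_mul]
  rw [ae_iff]
  simp only [not_not]
  rw [← (measurePreserving_insertMark hε b).measure_preimage hW.nullMeasurableSet,
    prod_apply_symm ((measurable_insertMark b) hW)]
  refine lintegral_eq_zero_of_ae_eq_zero (.of_forall fun ω => ?_)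
  refine measure_mono_null (fun e he => ?_)
    (hatom (markTime ω c n - ∑ i ∈ Finset.range m, (ω b i).1))
  have he' : markTime (insertMark b e ω) b m = markTime (insertMark b e ω) c n := he
  unfold markTime at he'
  rw [Finset.sum_range_succ'] at he'
  simp only [insertMark_self_succ, insertMark_self_zero, insertMark_of_ne hbc.symm] at he'
  simp only [Set.mem_ofPred_eq, markTime]
  linarith

theorem ae_regular (hε : 0 < ε) (B : Finset ℤ) : ∀ᵐ ω ∂(marksLaw ε), Regular B ω := by
  have h1 : ∀ᵐ ω ∂(marksLaw ε), ∀ b n, 0 < (ω b n).1 :=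
    ae_all_iff.2 fun b => ae_all_iff.2 fun n => ae_wait_pos hε b n
  have h2 : ∀ᵐ ω ∂(marksLaw ε), ∀ b, ∀ K : ℝ, ∃ n, K < markTime ω b n :=
    ae_all_iff.2 fun b => ae_markTime_unbounded hε b
  have h3 : ∀ᵐ ω ∂(marksLaw ε), ∀ b c : ℤ, b ≠ c → ∀ m n, markTime ω b m ≠ markTime ω c n := by
    refine ae_all_iff.2 fun b => ae_all_iff.2 fun c => ?_
    by_cases h : b = c
    · simp [h]
    · filter_upwards [ae_all_iff.2 fun m => ae_all_iff.2 fun n => ae_markTime_ne hε h m n]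
        with ω hω _ using hω
  filter_upwards [h1, h2, h3] with ω a1 a2 a3
  exact ⟨fun b _ => a1 b, fun b _ => a2 b, fun b _ c _ => a3 b c⟩

end AlmostSure

/-! ### Inclusion of the two events in cascades. -/

theorem bonds_nonempty {N : ℕ} (hN : 1 ≤ N) : (bonds N).Nonempty :=
  ⟨0, mem_bonds.2 ⟨by omega, by omega⟩⟩

/-- States of the pair of particles up to the first mark between them or the first time when
their distance reaches a given value. -/
inductive PairState
  | dead
  | escaped
  | live (x y : ℤ)

/-- Evolution of `PairState`. -/
def PairState.step (M : ℕ) : PairState → ℤ → Bool → PairState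
  | .dead, _, _ => .dead
  | .escaped, _, _ => .escaped
  | .live x y, b, a =>
    if Touch b x y then .dead
    else if (M : ℤ) ≤ |exchange b a x - exchange b a y| then .escaped
    else .live (exchange b a x) (exchange b a y)

theorem le_tau_iff {N : ℕ} {x y : ℤ} {ω : Marks} {t : ℝ} :
    (t : EReal) ≤ tau N x y ω ↔ ∀ p ∈ contactMarks N x y ω, t ≤ p.1 := by
  simp [tau, le_iInf_iff]

/-- Survival after an escape is estimated by probability one, so `escaped` is a target state and its
cascades must contain every regular realization. -/
theorem Regular.mem_cascade_escaped {N M : ℕ} {ω : Marks} (hN : 1 ≤ N)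
    (hg : Regular (bonds N) ω) (n : ℕ) (t : ℝ) :
    ω ∈ cascade (bonds N) {PairState.dead}ᶜ (PairState.step M) n .escaped t := by
  induction n generalizing ω t with
  | zero => trivial
  | succ n ih =>
    obtain ⟨b, hb, hf⟩ := hg.exists_isFirst (bonds_nonempty hN)
    rcases le_total t (ω b 0).1 with h | h
    · refine Or.inl ⟨by simp, fun c hc => h.trans ?_⟩
      rw [← markTime_zero ω c]
      exact hg.first_le_markTime hf hc 0
    · exact Or.inr ⟨b, hb, hf, h, ih (hg.afterFirst hb hf) _⟩

theorem Regular.mem_cascade_of_le_tau {N M : ℕ} {ω : Marks} (hN : 1 ≤ N)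
    (hg : Regular (bonds N) ω) (n : ℕ) {x y : ℤ} (hx : x ∈ box N) (hy : y ∈ box N) {t : ℝ}
    (ht : (t : EReal) ≤ tau N x y ω) :
    ω ∈ cascade (bonds N) {PairState.dead}ᶜ (PairState.step M) n (.live x y) t := by
  induction n generalizing ω t x y with
  | zero => trivial
  | succ n ih =>
    obtain ⟨b, hb, hf⟩ := hg.exists_isFirst (bonds_nonempty hN)
    have hg' := hg.afterFirst hb hf
    rw [le_tau_iff] at ht
    rcases le_or_gt t (ω b 0).1 with h | h
    · refine Or.inl ⟨by simp, fun c hc => h.trans ?_⟩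
      rw [← markTime_zero ω c]
      exact hg.first_le_markTime hf hc 0
    · refine Or.inr ⟨b, hb, hf, h.le, ?_⟩
      have hT : ¬ Touch b x y := fun hT =>
        absurd (ht _ ((hg.first_mem_contactMarks_iff hb hf hx hy _).2 ⟨hT, rfl⟩)) (not_le.2 h)
      rw [PairState.step, if_neg hT]
      split_ifs
      · exact hg'.mem_cascade_escaped hN n _
      · refine ih hg' (exchange_mem_box hb _ hx) (exchange_mem_box hb _ hy) ?_
        rw [le_tau_iff]
        rintro ⟨s, z⟩ hp
        have hs := hg'.pos_of_mem_markTimes (mem_markTimes_of_mem_contactMarks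
          (exchange_mem_box hb _ hx) (exchange_mem_box hb _ hy) hp).2
        have := ht _ ((hg.add_mem_contactMarks_iff hb hf hx hy hs z).2 hp)
        simp only at this ⊢
        linarith

/-- Evolution of the positions of the two particles and of the number of marks between them that
are still to come. -/
def countStep : ℕ × ℤ × ℤ → ℤ → Bool → ℕ × ℤ × ℤ
  | (j, x, y), b, a => (if Touch b x y then j - 1 else j, exchange b a x, exchange b a y)

/-- The first mark contributes at most one contact mark, and only if it touches the pair; the later
ones are shifted contact marks of the regenerated process. -/
theorem Regular.numMarks_le {N : ℕ} {ω : Marks} {b : ℤ} (hg : Regular (bonds N) ω)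
    (hb : b ∈ bonds N) (hf : IsFirst (bonds N) b ω) {x y : ℤ} (hx : x ∈ box N) (hy : y ∈ box N)
    (t : ℝ) :
    numMarks N x y t ω ≤ (if Touch b x y then 1 else 0) +
      numMarks N (exchange b (ω b 0).2 x) (exchange b (ω b 0).2 y) (t - (ω b 0).1)
        (Stirring.afterFirst (bonds N) b ω) := by
  set S : Set (ℝ × ℤ × ℤ) := if Touch b x y then
    {((ω b 0).1, exchange b (ω b 0).2 x, exchange b (ω b 0).2 y)} else ∅ with hS
  have hSc : S.encard ≤ if Touch b x y then 1 else 0 := by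
    rw [hS]; split_ifs <;> simp
  have hsub : {p | p ∈ contactMarks N x y ω ∧ p.1 ≤ t} ⊆ S ∪
      (fun p : ℝ × ℤ × ℤ => ((ω b 0).1 + p.1, p.2)) ''
        {p | p ∈ contactMarks N (exchange b (ω b 0).2 x) (exchange b (ω b 0).2 y)
          (Stirring.afterFirst (bonds N) b ω) ∧ p.1 ≤ t - (ω b 0).1} := by
    rintro ⟨s, z⟩ ⟨hp, hpt⟩
    rcases (hg.first_le hf (mem_markTimes_of_mem_contactMarks hx hy hp).2).eq_or_lt with h | h
    · simp only at h
      subst h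
      left
      obtain ⟨h1, rfl⟩ := (hg.first_mem_contactMarks_iff hb hf hx hy z).1 hp
      simp [hS, h1]
    · right
      simp only at h hpt
      refine ⟨(s - (ω b 0).1, z), ⟨?_, by simpa using hpt⟩, by simp⟩
      rw [← hg.add_mem_contactMarks_iff hb hf hx hy (by linarith), add_sub_cancel]
      exact hp
  refine (Set.encard_le_encard hsub).trans ((Set.encard_union_le _ _).trans ?_)
  exact add_le_add hSc (Set.encard_image_le _ _)

theorem Regular.mem_cascade_of_le_numMarks {N : ℕ} {ω : Marks} (hN : 1 ≤ N)
    (hg : Regular (bonds N) ω) (n : ℕ) {j : ℕ} {x y : ℤ} (hx : x ∈ box N) (hy : y ∈ box N) {t : ℝ}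
    (hj : (j : ℕ∞) ≤ numMarks N x y t ω) :
    ω ∈ cascade (bonds N) {i | i.1 = 0} countStep n (j, x, y) t := by
  induction n generalizing ω t x y j with
  | zero => trivial
  | succ n ih =>
    obtain ⟨b, hb, hf⟩ := hg.exists_isFirst (bonds_nonempty hN)
    have hg' := hg.afterFirst hb hf
    -- If marks are still required, one of them occurs by time `t`, and hence so does the first mark
    -- in the box.
    by_cases hcase : j = 0 ∧ t ≤ (ω b 0).1
    · refine Or.inl ⟨hcase.1, fun c hc => hcase.2.trans ?_⟩
      rw [← markTime_zero ω c]
      exact hg.first_le_markTime hf hc 0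
    · have hle : (ω b 0).1 ≤ t := by
        by_cases hj0 : j = 0
        · exact (not_le.1 fun h => hcase ⟨hj0, h⟩).le
        · have hne : {p | p ∈ contactMarks N x y ω ∧ p.1 ≤ t}.Nonempty := by
            rw [← Set.encard_ne_zero]
            intro h0
            rw [numMarks, h0] at hj
            exact hj0 (by simpa using hj)
          obtain ⟨p, hp, hpt⟩ := hne
          exact (hg.first_le hf (mem_markTimes_of_mem_contactMarks hx hy hp).2).trans hpt
      refine Or.inr ⟨b, hb, hf, hle, ?_⟩
      refine ih hg' (exchange_mem_box hb _ hx) (exchange_mem_box hb _ hy) ?_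
      have h1 := hj.trans (hg.numMarks_le hb hf hx hy t)
      split_ifs at h1 ⊢
      · rw [ENat.natCast_sub, Nat.cast_one]
        exact tsub_le_iff_left.2 h1
      · simpa using h1

/-! ### The generator of one and of two particles. -/

section Generator

variable {N : ℕ}

theorem exchange_false (b x : ℤ) : exchange b false x = x := by simp [exchange]

theorem touch_comm {b x y : ℤ} : Touch b x y ↔ Touch b y x := by unfold Touch; omega

theorem touch_iff_of_lt {b x y : ℤ} (h : x < y) : Touch b x y ↔ b = x ∧ y = x + 1 := by
  unfold Touch; omega

/-- Action of the generator on a function of the position of one particle. -/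
theorem sum_bonds_exchange {x : ℤ} (hx : x ∈ box N) (H : ℤ → ℝ) :
    ∑ b ∈ bonds N, (H (exchange b true x) - H x) =
      (if x < N then H (x + 1) - H x else 0) + (if -(N : ℤ) < x then H (x - 1) - H x else 0) := by
  have h : ∀ b ∈ bonds N, H (exchange b true x) - H x =
      (if b = x then H (x + 1) - H x else 0) + (if b = x - 1 then H (x - 1) - H x else 0) := by
    intro b _
    by_cases h1 : b = x
    · subst h1
      have : ¬ b = b - 1 := by omega
      simp [exchange, this]
    · by_cases h2 : b = x - 1
      · subst h2
        have : ¬ x = x - 1 := by omega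
        simp [exchange, this, h1]
      · have : exchange b true x = x := by
          simp only [exchange, true_and]
          split_ifs <;> omega
        simp [this, h1, h2]
  rw [Finset.sum_congr rfl h, Finset.sum_add_distrib, Finset.sum_ite_eq', Finset.sum_ite_eq']
  rw [mem_box] at hx
  congr 1
  · exact if_congr (by rw [mem_bonds]; omega) rfl rfl
  · exact if_congr (by rw [mem_bonds]; omega) rfl rfl

/-- Action of the generator on a function of the distance of the two particles. -/
theorem sum_bonds_gap {x y : ℤ} (hx : x ∈ box N) (hy : y ∈ box N) (hxy : x < y) (F : ℤ → ℝ)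
    (κ : ℝ) :
    ∑ b ∈ bonds N, (if Touch b x y then κ
        else F |exchange b true x - exchange b true y| - F |x - y|) =
      (if y = x + 1 then κ else 2 * (F (y - x - 1) - F (y - x))) +
      ((if -(N : ℤ) < x then 1 else 0) + (if y < N then 1 else 0)) *
        (F (y - x + 1) - F (y - x)) := by
  have e0 : |x - y| = y - x := by rw [abs_of_neg] <;> omega
  have h : ∀ b ∈ bonds N, (if Touch b x y then κ
        else F |exchange b true x - exchange b true y| - F |x - y|) =
      (if b = x then (if y = x + 1 then κ else F (y - x - 1) - F (y - x)) else 0) +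
      (if b = y - 1 then (if y = x + 1 then 0 else F (y - x - 1) - F (y - x)) else 0) +
      (if b = x - 1 then F (y - x + 1) - F (y - x) else 0) +
      (if b = y then F (y - x + 1) - F (y - x) else 0) := by
    intro b _
    simp only [touch_iff_of_lt hxy, e0]
    -- Only the pairs on either side of a particle change the distance. For neighbours the inner
    -- pair swaps them and leaves the distance equal to `1`.
    have key : |exchange b true x - exchange b true y| =
        if b = x ∧ y ≠ x + 1 then y - x - 1 else if b = y - 1 ∧ y ≠ x + 1 then y - x - 1
        else if b = x - 1 then y - x + 1 else if b = y then y - x + 1 else y - x := by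
      simp only [exchange, true_and]
      rcases abs_cases ((if x = b then b + 1 else if x = b + 1 then b else x) -
        (if y = b then b + 1 else if y = b + 1 then b else y)) with ⟨h, _⟩ | ⟨h, _⟩ <;>
      rw [h] <;> split_ifs at * <;> omega
    rw [key]
    by_cases hadj : y = x + 1
    · subst hadj
      by_cases h1 : b = x
      · subst h1
        have : ¬ b = b - 1 := by omega
        simp [this]
      · by_cases h2 : b = x - 1
        · subst h2
          have : ¬ x - 1 = x + 1 := by omega
          simp [this]
        · by_cases h3 : b = x + 1
          · subst h3
            simp [h2]
          · simp [h1, h2, h3]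
    · by_cases h1 : b = x
      · subst h1
        have a1 : ¬ b = y - 1 := by omega
        have a3 : ¬ b = y := by omega
        have a4 : ¬ b = b - 1 := by omega
        simp [hadj, a1, a3, a4]
      · by_cases h2 : b = y - 1
        · subst h2
          have a1 : ¬ y - 1 = x - 1 := by omega
          simp [hadj, a1, h1]
        · by_cases h3 : b = x - 1
          · subst h3
            have a1 : ¬ x - 1 = y := by omega
            simp [hadj, a1, h2]
          · simp [h1, h2, h3]
            split_ifs <;> simp
  rw [Finset.sum_congr rfl h, Finset.sum_add_distrib, Finset.sum_add_distrib,
    Finset.sum_add_distrib, Finset.sum_ite_eq', Finset.sum_ite_eq', Finset.sum_ite_eq',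
    Finset.sum_ite_eq']
  rw [mem_box] at hx hy
  have m1 : x ∈ bonds N := by rw [mem_bonds]; omega
  have m2 : y - 1 ∈ bonds N := by rw [mem_bonds]; omega
  have m3 : x - 1 ∈ bonds N ↔ -(N : ℤ) < x := by rw [mem_bonds]; omega
  have m4 : y ∈ bonds N ↔ y < N := by rw [mem_bonds]; omega
  simp only [m1, m2, m3, m4, if_true]
  split_ifs <;> ring

end Generator

/-! ### Tail of the first mark between the particles. -/

section FirstMark

/-- The bound for the pair at distance `d`, when a time `ρ` of the horizon `s` has passed. -/
def gapBound (M : ℕ) (s ρ d : ℝ) : ℝ := d / M + (d * (M - d) / 2 + ρ) / s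

/-- The bound `gapBound`, replaced by `1` when the distance is at least `M`. -/
def cappedGapBound (M : ℕ) (s ρ : ℝ) (d : ℤ) : ℝ := if (M : ℤ) ≤ d then 1 else gapBound M s ρ d

/-- The supersolution for the first mark between the particles. -/
def survivalBound (M : ℕ) (s r t τ : ℝ) : PairState → ℝ
  | .dead => 0
  | .escaped => 1
  | .live x y => gapBound M s (r * (t - τ)) ((|x - y| : ℤ) : ℝ)

/-- The states that are reached from neighbouring sites. -/
def survivalStates (N M : ℕ) : Set PairState
  | .dead => True
  | .escaped => True
  | .live x y => x ∈ box N ∧ y ∈ box N ∧ x ≠ y ∧ |x - y| < M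

/-- As a function of `d`, `gapBound` is a linear term plus a parabola with second difference `-1/s`,
and two particles double this. The value `-2 * gapBound` on a touching pair reflects that both
attributes kill. The condition `M² ≤ s` makes `gapBound` increase up to `M`, so that moves blocked
by the walls do no harm. -/
theorem survivalBound_generator_of_lt {N M : ℕ} {s ρ : ℝ} (hM : 1 ≤ M) (hs : (M : ℝ) ^ 2 ≤ s)
    (hρ : 0 ≤ ρ) {x y : ℤ} (hx : x ∈ box N) (hy : y ∈ box N) (hxy : x < y) (hd : y - x < M) :
    ∑ b ∈ bonds N, (if Touch b x y then -2 * gapBound M s ρ ((|x - y| : ℤ) : ℝ) else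
      cappedGapBound M s ρ |exchange b true x - exchange b true y| -
        cappedGapBound M s ρ |x - y|) ≤ -(2 / s) := by
  have e0 : |x - y| = y - x := by rw [abs_of_neg] <;> omega
  rw [sum_bonds_gap hx hy hxy]
  have hM0 : (1 : ℝ) ≤ M := by exact_mod_cast hM
  have hs0 : 0 < s := lt_of_lt_of_le (by positivity) hs
  simp only [cappedGapBound, if_neg (not_le.2 hd), if_neg (not_le.2 (by omega : y - x - 1 < M)), e0]
  set d : ℤ := y - x with hdd
  set G : ℝ → ℝ := gapBound M s ρ with hG
  have hd1 : (1 : ℝ) ≤ d := by exact_mod_cast (by omega : 1 ≤ d)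
  have hdM : (d : ℝ) + 1 ≤ M := by exact_mod_cast (by omega : d + 1 ≤ M)
  have hup : 0 ≤ G (d + 1) - G d := by
    have e1 : G (d + 1) - G d = 1 / M - (2 * d + 1 - M) / (2 * s) := by
      simp only [hG, gapBound]; field_simp; ring
    have : (2 * d + 1 - M) / (2 * s) ≤ 1 / M := by
      rw [div_le_div_iff₀ (by positivity) (by positivity)]
      nlinarith
    rw [e1]; linarith
  have hsec : (G (d - 1) - G d) + (G (d + 1) - G d) = -(1 / s) := by
    simp only [hG, gapBound]; field_simp; ring
  -- On escape the value `1` is below the uncapped value `1 + ρ / s` at distance `M`.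
  have hup' : (if (M : ℤ) ≤ d + 1 then 1 else gapBound M s ρ ((d + 1 : ℤ) : ℝ)) ≤ G (d + 1) := by
    split_ifs with h
    · have : (d : ℝ) + 1 = M := le_antisymm hdM (by exact_mod_cast h)
      rw [hG, this, gapBound, sub_self, mul_zero, zero_div, zero_add, div_self (by positivity)]
      have : 0 ≤ ρ / s := by positivity
      linarith
    · push_cast; rfl
  -- At distance `1`, death gives the value `0` instead of `G 0 = ρ / s ≥ 0`.
  have hdown : (if y = x + 1 then -2 * G d else 2 * (G ((d - 1 : ℤ) : ℝ) - G d)) ≤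
      2 * (G (d - 1) - G d) := by
    split_ifs with h
    · have : (d : ℝ) = 1 := by rw [hdd, h]; push_cast; ring
      have h0 : 0 ≤ G (d - 1) := by
        rw [this, sub_self, hG, gapBound]
        simp only [zero_div, zero_mul, zero_add]
        positivity
      linarith
    · push_cast; rfl
  have hk : ((if -(N : ℤ) < x then (1 : ℝ) else 0) + (if y < N then 1 else 0)) *
      ((if (M : ℤ) ≤ d + 1 then 1 else gapBound M s ρ ((d + 1 : ℤ) : ℝ)) - G d) ≤
        2 * (G (d + 1) - G d) := by
    have h0 : 0 ≤ (if -(N : ℤ) < x then (1 : ℝ) else 0) + (if y < N then 1 else 0) := by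
      split_ifs <;> norm_num
    have h2 : (if -(N : ℤ) < x then (1 : ℝ) else 0) + (if y < N then 1 else 0) ≤ 2 := by
      split_ifs <;> norm_num
    exact (mul_le_mul_of_nonneg_left (by linarith) h0).trans (mul_le_mul_of_nonneg_right h2 hup)
  have : 2 / s = 2 * (1 / s) := by ring
  rw [this]
  linarith

theorem survivalBound_generator {N M : ℕ} {s ρ : ℝ} (hM : 1 ≤ M) (hs : (M : ℝ) ^ 2 ≤ s)
    (hρ : 0 ≤ ρ) {x y : ℤ} (hx : x ∈ box N) (hy : y ∈ box N) (hxy : x ≠ y) (hd : |x - y| < M) :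
    ∑ b ∈ bonds N, (if Touch b x y then -2 * gapBound M s ρ ((|x - y| : ℤ) : ℝ) else
      cappedGapBound M s ρ |exchange b true x - exchange b true y| -
        cappedGapBound M s ρ |x - y|) ≤ -(2 / s) := by
  rcases lt_or_gt_of_ne hxy with h | h
  · exact survivalBound_generator_of_lt hM hs hρ hx hy h (by
      rw [abs_of_neg] at hd <;> omega)
  · have := survivalBound_generator_of_lt hM hs hρ hy hx h (by
      rw [abs_of_pos] at hd <;> omega)
    simpa only [touch_comm (x := y), abs_sub_comm y x,
      fun b => abs_sub_comm (exchange b true y) (exchange b true x)] using this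

theorem marksLaw_le_tau_le {N M : ℕ} {ε t : ℝ} (hN : 1 ≤ N) (hε : 0 < ε) (ht : 0 < t)
    (hM : 2 ≤ M) (hMs : (M : ℝ) ^ 2 ≤ ε⁻¹ ^ 2 * t) {x y : ℤ} (hx : x ∈ box N) (hy : y ∈ box N)
    (hxy : |x - y| = 1) :
    (marksLaw ε).real {ω | (t : EReal) ≤ tau N x y ω} ≤
      1 / M + M / (2 * (ε⁻¹ ^ 2 * t)) := by
  set r : ℝ := ε⁻¹ ^ 2 with hr
  have hr0 : 0 < r := by positivity
  set s : ℝ := r * t with hs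
  have hs0 : 0 < s := by positivity
  have hM0 : (2 : ℝ) ≤ M := by exact_mod_cast hM
  have main := marksLaw_real_le_of_subset_cascade (B := bonds N) (F := {PairState.dead}ᶜ)
    (step := PairState.step M) hε (T := t) (I := survivalStates N M)
    (u := fun τ i => survivalBound M s r t τ i)
    (u' := fun _ i => match i with
      | .dead => 0
      | .escaped => 0
      | .live _ _ => -(r / s))
    (i := .live x y) (t := t) (A := {ω | (t : EReal) ≤ tau N x y ω})
    ?_ ?_ ?_ ?_ ?_ ?_ ⟨ht.le, le_rfl⟩ ?_
  · refine main.trans ?_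
    simp only [survivalBound, gapBound, hxy, sub_self, mul_zero, add_zero, Int.cast_one, one_mul]
    have : ((M : ℝ) - 1) / 2 / s ≤ M / (2 * s) := by
      rw [div_div]
      gcongr
      linarith
    linarith
  · rintro (_ | _ | ⟨x, y⟩) hi b hb a
    · trivial
    · trivial
    · obtain ⟨h1, h2, h3, h4⟩ := hi
      simp only [PairState.step]
      split_ifs with c1 c2
      · trivial
      · trivial
      · exact ⟨exchange_mem_box hb a h1, exchange_mem_box hb a h2, exchange_ne a h3, not_le.1 c2⟩
  · rintro (_ | _ | ⟨x, y⟩) hi τ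
    · exact hasDerivAt_const _ _
    · exact hasDerivAt_const _ _
    · simp only [survivalBound, gapBound]
      have h1 : HasDerivAt (fun τ : ℝ => t - τ) (-1) τ := by
        simpa using (hasDerivAt_id τ).const_sub t
      refine ((((h1.const_mul r).const_add _).div_const s).const_add _).congr_deriv ?_
      ring
  · rintro (_ | _ | ⟨x, y⟩) hi τ hτ
    · exact le_rfl
    · exact zero_le_one
    · obtain ⟨_, _, _, h4⟩ := hi
      have h5 : ((|x - y| : ℤ) : ℝ) ≤ M := by exact_mod_cast h4.le
      have h6 : (0 : ℝ) ≤ ((|x - y| : ℤ) : ℝ) := by exact_mod_cast abs_nonneg _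
      have h7 : 0 ≤ r * (t - τ) := mul_nonneg hr0.le (by linarith [hτ.2])
      have h8 : 0 ≤ (M : ℝ) - ((|x - y| : ℤ) : ℝ) := by linarith
      simp only [survivalBound, gapBound]
      positivity
  · rintro (_ | _ | ⟨x, y⟩) hi hF
    · exact absurd rfl hF
    · exact le_rfl
    · obtain ⟨_, _, _, h4⟩ := hi
      have h5 : ((|x - y| : ℤ) : ℝ) ≤ M := by exact_mod_cast h4.le
      have h6 : (0 : ℝ) ≤ ((|x - y| : ℤ) : ℝ) := by exact_mod_cast abs_nonneg _
      have h8 : 0 ≤ (M : ℝ) - ((|x - y| : ℤ) : ℝ) := by linarith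
      simp only [survivalBound, gapBound, sub_zero, ← hs, add_div, div_self hs0.ne']
      have h9 : 0 ≤ ((|x - y| : ℤ) : ℝ) / M := by positivity
      have h10 : 0 ≤ ((|x - y| : ℤ) : ℝ) * (M - ((|x - y| : ℤ) : ℝ)) / 2 / s := by positivity
      linarith
  · rintro (_ | _ | ⟨x, y⟩) hi τ hτ
    · simp [PairState.step]
    · simp [PairState.step]
    · obtain ⟨h1, h2, h3, h4⟩ := hi
      have h7 : 0 ≤ r * (t - τ) := mul_nonneg hr0.le (by linarith [hτ.2])
      have key := survivalBound_generator (by omega) hMs h7 h1 h2 h3 h4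
      have heq : ∑ b ∈ bonds N, ∑ a : Bool,
          (survivalBound M s r t τ (PairState.step M (.live x y) b a) -
            survivalBound M s r t τ (.live x y)) =
          ∑ b ∈ bonds N, (if Touch b x y then
            -2 * gapBound M s (r * (t - τ)) ((|x - y| : ℤ) : ℝ) else
            cappedGapBound M s (r * (t - τ)) |exchange b true x - exchange b true y| -
            cappedGapBound M s (r * (t - τ)) |x - y|) := by
        refine Finset.sum_congr rfl fun b _ => ?_
        simp only [Fintype.sum_bool, PairState.step, exchange_false, cappedGapBound, if_neg (not_le.2 h4)]
        by_cases hT : Touch b x y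
        · simp only [hT, if_true, survivalBound]
          ring
        · simp only [hT, if_false, sub_self, add_zero]
          split_ifs <;> simp [survivalBound]
      change r / 2 * _ ≤ -(r / s)
      rw [heq]
      have : -(r / s) = r / 2 * (-(2 / s)) := by ring
      rw [this]
      exact mul_le_mul_of_nonneg_left key (by positivity)
  · exact ⟨hx, hy, fun h => by simp [h] at hxy, by rw [hxy]; exact_mod_cast hM⟩
  · filter_upwards [ae_regular hε (bonds N)] with ω hg hω n
    exact hg.mem_cascade_of_le_tau hN n hx hy hω

end FirstMark

/-! ### Exponential tail of the number of marks between the particles. -/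

section NumberOfMarks

/-- A truncated parabola that decreases from `1` to `0` on `[0, M]`. -/
def parabola (M : ℕ) (k : ℤ) : ℝ := (max ((M : ℝ) - k) 0) ^ 2 / (M : ℝ) ^ 2

section Parabola

variable {M : ℕ}

theorem parabola_nonneg (k : ℤ) : 0 ≤ parabola M k := by unfold parabola; positivity

theorem parabola_le_one (hM : 1 ≤ M) {k : ℤ} (hk : 0 ≤ k) : parabola M k ≤ 1 := by
  have hM0 : (1 : ℝ) ≤ M := by exact_mod_cast hM
  have hk0 : (0 : ℝ) ≤ k := by exact_mod_cast hk
  unfold parabola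
  rw [div_le_one (by positivity)]
  exact pow_le_pow_left₀ (le_max_right _ _) (max_le (by linarith) (by linarith)) 2

theorem parabola_eq_zero {k : ℤ} (hk : (M : ℤ) ≤ k) : parabola M k = 0 := by
  have hk0 : (M : ℝ) ≤ k := by exact_mod_cast hk
  unfold parabola
  rw [max_eq_right (by linarith)]
  simp

theorem parabola_second_difference (hM : 1 ≤ M) (k : ℤ) :
    (parabola M (k + 1) - parabola M k) + (parabola M (k - 1) - parabola M k) ≤
      2 / (M : ℝ) ^ 2 := by
  have hM0 : (1 : ℝ) ≤ M := by exact_mod_cast hM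
  unfold parabola
  rw [← sub_div, ← sub_div, ← add_div]
  refine div_le_div_of_nonneg_right ?_ (by positivity)
  push_cast
  rcases max_cases ((M : ℝ) - (k + 1)) 0 with ⟨h1, h1'⟩ | ⟨h1, h1'⟩ <;>
  rcases max_cases ((M : ℝ) - k) 0 with ⟨h2, h2'⟩ | ⟨h2, h2'⟩ <;>
  rcases max_cases ((M : ℝ) - (k - 1)) 0 with ⟨h3, h3'⟩ | ⟨h3, h3'⟩ <;>
  rw [h1, h2, h3] <;> nlinarith

/-- The decrement is largest at `k = 0`, where it is attained. A wall term therefore gains at the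
wall at least what the distance term loses by one blocked outward move. -/
theorem parabola_sub_le (hM : 1 ≤ M) {k : ℤ} (hk : 0 ≤ k) :
    parabola M k - parabola M (k + 1) ≤ (2 * M - 1) / (M : ℝ) ^ 2 := by
  have hM0 : (1 : ℝ) ≤ M := by exact_mod_cast hM
  have hk0 : (0 : ℝ) ≤ k := by exact_mod_cast hk
  unfold parabola
  rw [← sub_div]
  refine div_le_div_of_nonneg_right ?_ (by positivity)
  push_cast
  rcases max_cases ((M : ℝ) - (k + 1)) 0 with ⟨h1, h1'⟩ | ⟨h1, h1'⟩ <;>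
  rcases max_cases ((M : ℝ) - k) 0 with ⟨h2, h2'⟩ | ⟨h2, h2'⟩ <;>
  rw [h1, h2] <;> nlinarith

theorem parabola_one_sub_zero (hM : 1 ≤ M) :
    parabola M 1 - parabola M 0 = -((2 * M - 1) / (M : ℝ) ^ 2) := by
  have hM0 : (1 : ℝ) ≤ M := by exact_mod_cast hM
  unfold parabola
  push_cast
  rw [max_eq_left (by linarith), max_eq_left (by linarith)]
  ring

theorem parabola_two_sub_one (hM : 1 ≤ M) :
    parabola M 2 - parabola M 1 ≤ -((2 * M - 3) / (M : ℝ) ^ 2) := by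
  have hM0 : (1 : ℝ) ≤ M := by exact_mod_cast hM
  unfold parabola
  push_cast
  rw [← sub_div, ← neg_div]
  refine div_le_div_of_nonneg_right ?_ (by positivity)
  rw [max_eq_left (by linarith : (0 : ℝ) ≤ M - 1)]
  rcases hM.eq_or_lt with h | h
  · rw [← h]; norm_num
  · have h2 : (2 : ℝ) ≤ M := by exact_mod_cast h
    rw [max_eq_left (by linarith)]
    nlinarith

end Parabola

/-- The contribution of the walls to the supersolution `pairWeight`. -/
def wallWeight (N M : ℕ) (x : ℤ) : ℝ := parabola M (x + N) + parabola M (N - x)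

/-- A function of the positions of the two particles that is large when they are close to each
other or to the walls. -/
def pairWeight (N M : ℕ) (x y : ℤ) : ℝ :=
  1 + parabola M |x - y| + (wallWeight N M x + wallWeight N M y)

variable {N M : ℕ}

theorem one_le_pairWeight (x y : ℤ) : 1 ≤ pairWeight N M x y := by
  unfold pairWeight wallWeight
  linarith [parabola_nonneg (M := M) |x - y|, parabola_nonneg (M := M) (x + N),
    parabola_nonneg (M := M) (N - x), parabola_nonneg (M := M) (y + N),
    parabola_nonneg (M := M) (N - y)]

theorem pairWeight_le (hM : 1 ≤ M) {x y : ℤ} (hx : x ∈ box N) (hy : y ∈ box N) :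
    pairWeight N M x y ≤ 6 := by
  rw [mem_box] at hx hy
  unfold pairWeight wallWeight
  linarith [parabola_le_one hM (abs_nonneg (x - y)), parabola_le_one hM (by omega : 0 ≤ x + N),
    parabola_le_one hM (by omega : 0 ≤ N - x), parabola_le_one hM (by omega : 0 ≤ y + N),
    parabola_le_one hM (by omega : 0 ≤ N - y)]

theorem pairWeight_comm (x y : ℤ) : pairWeight N M x y = pairWeight N M y x := by
  unfold pairWeight
  rw [abs_sub_comm, add_comm (wallWeight N M x)]

/-- Each of the two parabolas costs at most `2 / M²` in the interior. At a wall only the inward move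
remains and decreases the near parabola by its maximal step; the far one vanishes there because `M ≤
N`. -/
theorem sum_bonds_wallWeight_le (hN : 1 ≤ N) (hM : 1 ≤ M) (hMN : M ≤ N) {x : ℤ}
    (hx : x ∈ box N) :
    ∑ b ∈ bonds N, (wallWeight N M (exchange b true x) - wallWeight N M x) ≤
      4 / (M : ℝ) ^ 2 -
        (if x = -(N : ℤ) ∨ x = N then 1 else 0) * ((2 * M - 1) / (M : ℝ) ^ 2) := by
  rw [sum_bonds_exchange hx]
  have h4 : 0 ≤ 4 / (M : ℝ) ^ 2 := by positivity
  have hwall := parabola_one_sub_zero hM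
  rw [mem_box] at hx
  by_cases h1 : x = -(N : ℤ)
  · subst h1
    have c1 : -(N : ℤ) < N := by omega
    have e1 : -(N : ℤ) + 1 + N = 1 := by ring
    have e2 : -(N : ℤ) + N = 0 := by ring
    simp only [c1, lt_irrefl, if_true, if_false, wallWeight, true_or, e1, e2]
    rw [parabola_eq_zero (by omega : (M : ℤ) ≤ N - (-(N : ℤ) + 1)),
      parabola_eq_zero (by omega : (M : ℤ) ≤ N - -(N : ℤ))]
    linarith
  · by_cases h2 : x = N
    · subst h2
      have c1 : -(N : ℤ) < N := by omega
      have e1 : (N : ℤ) - (N - 1) = 1 := by ring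
      simp only [c1, lt_irrefl, if_true, if_false, wallWeight, or_true, e1, sub_self]
      rw [parabola_eq_zero (by omega : (M : ℤ) ≤ (N : ℤ) - 1 + N),
        parabola_eq_zero (by omega : (M : ℤ) ≤ (N : ℤ) + N)]
      linarith
    · have c1 : x < N := by omega
      have c2 : -(N : ℤ) < x := by omega
      simp only [c1, c2, h1, h2, if_true, wallWeight, or_self, if_false]
      have k1 := parabola_second_difference hM (x + N)
      have k2 := parabola_second_difference hM (N - x)
      have e1 : x + 1 + N = x + N + 1 := by ring
      have e2 : (N : ℤ) - (x + 1) = N - x - 1 := by ring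
      have e3 : x - 1 + N = x + N - 1 := by ring
      have e4 : (N : ℤ) - (x - 1) = N - x + 1 := by ring
      rw [e1, e2, e3, e4]
      have : 4 / (M : ℝ) ^ 2 = 2 / (M : ℝ) ^ 2 + 2 / (M : ℝ) ^ 2 := by ring
      rw [this]
      linarith

theorem wallWeight_exchange_of_touch {b x y : ℤ} (h : Touch b x y) (a : Bool) :
    wallWeight N M (exchange b a x) + wallWeight N M (exchange b a y) =
      wallWeight N M x + wallWeight N M y := by
  cases a
  · simp [exchange_false]
  · rcases h with ⟨rfl, rfl⟩ | ⟨rfl, rfl⟩ <;> simp [exchange, add_comm]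

theorem pairWeight_exchange_of_touch {b x y : ℤ} (h : Touch b x y) (a : Bool) :
    pairWeight N M (exchange b a x) (exchange b a y) = pairWeight N M x y := by
  unfold pairWeight
  rw [wallWeight_exchange_of_touch h]
  congr 2
  cases a
  · simp [exchange_false]
  · rcases h with ⟨rfl, rfl⟩ | ⟨rfl, rfl⟩ <;> simp [exchange]

/-- The constant `14` is `6` from the distance term together with the contact gain, plus `4` from
the wall weight of each particle; then `1 ≤ pairWeight` is used. A mark between the particles leaves
`pairWeight` unchanged, so there only the gain of the counter is charged. -/
theorem pairWeight_generator_of_lt (hN : 1 ≤ N) (hM : 1 ≤ M) (hMN : M ≤ N) {x y : ℤ}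
    (hx : x ∈ box N) (hy : y ∈ box N) (hxy : x < y) :
    ∑ b ∈ bonds N, (if Touch b x y then 2 * (1 / (4 * M)) * pairWeight N M x y else
      pairWeight N M (exchange b true x) (exchange b true y) - pairWeight N M x y) ≤
      14 / (M : ℝ) ^ 2 * pairWeight N M x y := by
  have hM0 : (1 : ℝ) ≤ M := by exact_mod_cast hM
  have hsplit : ∀ b ∈ bonds N,
      (if Touch b x y then 2 * (1 / (4 * M)) * pairWeight N M x y else
        pairWeight N M (exchange b true x) (exchange b true y) - pairWeight N M x y) =
      (if Touch b x y then 2 * (1 / (4 * M)) * pairWeight N M x y else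
        parabola M |exchange b true x - exchange b true y| - parabola M |x - y|) +
      ((wallWeight N M (exchange b true x) - wallWeight N M x) +
        (wallWeight N M (exchange b true y) - wallWeight N M y)) := by
    intro b _
    split_ifs with h
    · have := wallWeight_exchange_of_touch (N := N) (M := M) h true
      linarith
    · unfold pairWeight
      ring
  rw [Finset.sum_congr rfl hsplit, Finset.sum_add_distrib, Finset.sum_add_distrib,
    sum_bonds_gap hx hy hxy]
  have hwx := sum_bonds_wallWeight_le hN hM hMN hx
  have hwy := sum_bonds_wallWeight_le hN hM hMN hy
  have hψ1 := one_le_pairWeight (N := N) (M := M) x y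
  have hψ6 := pairWeight_le hM hx hy
  rw [mem_box] at hx hy
  set ψ := pairWeight N M x y
  set d : ℤ := y - x with hd
  set q : ℝ := ((M : ℝ) ^ 2)⁻¹ with hq
  have hq0 : 0 < q := by positivity
  set D : ℝ := parabola M d - parabola M (d + 1) with hD
  have hDle : D ≤ (2 * M - 1) * q := parabola_sub_le hM (by omega)
  simp only [div_eq_mul_inv, ← hq] at hwx hwy ⊢
  -- Each outward move blocked by a wall loses a drift `-D`, and the wall term supplies `-(2M - 1)q
  -- ≤ -D` in its place. Since `x < y`, only the left wall blocks `x` outward and only the right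
  -- wall blocks `y`.
  have hcount : ((if -(N : ℤ) < x then (1 : ℝ) else 0) + (if y < N then 1 else 0)) *
        (parabola M (d + 1) - parabola M d) -
        (if x = -(N : ℤ) ∨ x = N then 1 else 0) * ((2 * M - 1) * q) -
        (if y = -(N : ℤ) ∨ y = N then 1 else 0) * ((2 * M - 1) * q) ≤ -2 * D := by
    have e : parabola M (d + 1) - parabola M d = -D := by rw [hD]; ring
    rw [e]
    have a1 : (x = -(N : ℤ) ∨ x = N) ↔ ¬ (-(N : ℤ) < x) := by omega
    have a2 : (y = -(N : ℤ) ∨ y = N) ↔ ¬ (y < N) := by omega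
    simp only [a1, a2]
    split_ifs <;> linarith
  -- At contact the gain is at most `3Mq`, because `ψ ≤ 6`, against a drift of at most `-2(2M -
  -- 3)q`; the sum is `(6 - M)q`. Otherwise two second differences give `4q`.
  have hmain : (if y = x + 1 then 2 * (1 * (4 * (M : ℝ))⁻¹) * ψ
      else 2 * (parabola M (d - 1) - parabola M d)) - 2 * D ≤ 6 * q := by
    split_ifs with h
    · have hd1 : d = 1 := by omega
      have h1 : -D ≤ -((2 * M - 3) * q) := by
        have := parabola_two_sub_one hM
        rw [div_eq_mul_inv] at this
        rw [hD, hd1]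
        norm_num
        linarith
      have h2 : 2 * (1 * (4 * (M : ℝ))⁻¹) * ψ ≤ 3 * M * q := by
        have : 3 * M * q = 2 * (1 * (4 * (M : ℝ))⁻¹) * 6 := by
          rw [hq]; field_simp; norm_num
        rw [this]
        gcongr
      nlinarith
    · have := parabola_second_difference hM d
      rw [div_eq_mul_inv] at this
      rw [hD]
      nlinarith
  have : 14 * q ≤ 14 * q * ψ := le_mul_of_one_le_right (by positivity) hψ1
  linarith

theorem pairWeight_generator (hN : 1 ≤ N) (hM : 1 ≤ M) (hMN : M ≤ N) {x y : ℤ}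
    (hx : x ∈ box N) (hy : y ∈ box N) (hxy : x ≠ y) :
    ∑ b ∈ bonds N, (if Touch b x y then 2 * (1 / (4 * M)) * pairWeight N M x y else
      pairWeight N M (exchange b true x) (exchange b true y) - pairWeight N M x y) ≤
      14 / (M : ℝ) ^ 2 * pairWeight N M x y := by
  rcases lt_or_gt_of_ne hxy with h | h
  · exact pairWeight_generator_of_lt hN hM hMN hx hy h
  · have := pairWeight_generator_of_lt hN hM hMN hy hx h
    simpa only [touch_comm (x := y), pairWeight_comm y x,
      fun b => pairWeight_comm (N := N) (M := M) (exchange b true y) (exchange b true x)] using this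

theorem marksLaw_le_numMarks_le {ε t : ℝ} (hN : 1 ≤ N) (hε : 0 < ε) (ht : 0 ≤ t) (hM : 1 ≤ M)
    (hMN : M ≤ N) {x y : ℤ} (hx : x ∈ box N) (hy : y ∈ box N) (hxy : x ≠ y) (j : ℕ) :
    (marksLaw ε).real {ω | (j : ℕ∞) ≤ numMarks N x y t ω} ≤
      6 * Real.exp (7 * (ε⁻¹ ^ 2 * t) / (M : ℝ) ^ 2) * ((1 + 1 / (4 * M : ℝ))⁻¹) ^ j := by
  have hM0 : (1 : ℝ) ≤ M := by exact_mod_cast hM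
  set r : ℝ := ε⁻¹ ^ 2 with hr
  have hr0 : 0 < r := by positivity
  set δ : ℝ := 1 / (4 * M) with hδ
  have hδ0 : 0 < δ := by positivity
  set q : ℝ := (1 + δ)⁻¹ with hq
  have hq0 : 0 < q := by positivity
  have hqδ : (1 + δ) * q = 1 := mul_inv_cancel₀ (by positivity)
  -- For `j = 0` the truncated subtraction leaves the counter unchanged, and `1 ≤ 1 + δ` suffices.
  have hqj : ∀ j : ℕ, q ^ (j - 1) ≤ (1 + δ) * q ^ j := by
    intro j
    cases j with
    | zero => simp [hδ0.le]
    | succ j => rw [Nat.add_sub_cancel, pow_succ']; rw [← mul_assoc, hqδ, one_mul]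
  set κ : ℝ := 7 * r / (M : ℝ) ^ 2 with hκ
  have main := marksLaw_real_le_of_subset_cascade (B := bonds N) (F := {i : ℕ × ℤ × ℤ | i.1 = 0})
    (step := countStep) hε (T := t)
    (I := {i | i.2.1 ∈ box N ∧ i.2.2 ∈ box N ∧ i.2.1 ≠ i.2.2})
    (u := fun τ i => q ^ i.1 * pairWeight N M i.2.1 i.2.2 * Real.exp (κ * τ))
    (u' := fun τ i => q ^ i.1 * pairWeight N M i.2.1 i.2.2 * (Real.exp (κ * τ) * κ))
    (i := (j, x, y)) (t := t) (A := {ω | (j : ℕ∞) ≤ numMarks N x y t ω})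
    ?_ ?_ ?_ ?_ ?_ ⟨hx, hy, hxy⟩ ⟨ht, le_rfl⟩ ?_
  · refine main.trans ?_
    have e : κ * t = 7 * (r * t) / (M : ℝ) ^ 2 := by rw [hκ]; ring
    simp only [e]
    have h6 := pairWeight_le hM hx hy
    calc q ^ j * pairWeight N M x y * Real.exp (7 * (r * t) / (M : ℝ) ^ 2)
        ≤ q ^ j * 6 * Real.exp (7 * (r * t) / (M : ℝ) ^ 2) := by gcongr
      _ = _ := by ring
  · rintro ⟨i, x, y⟩ ⟨h1, h2, h3⟩ b hb a
    exact ⟨exchange_mem_box hb a h1, exchange_mem_box hb a h2, exchange_ne a h3⟩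
  · rintro ⟨i, x, y⟩ _ τ
    refine HasDerivAt.const_mul _ ?_
    simpa using ((hasDerivAt_id τ).const_mul κ).exp
  · rintro ⟨i, x, y⟩ _ τ _
    have := one_le_pairWeight (N := N) (M := M) x y
    simp only
    positivity
  · rintro ⟨i, x, y⟩ _ hi
    obtain rfl : i = 0 := hi
    simpa using one_le_pairWeight (N := N) (M := M) x y
  · rintro ⟨i, x, y⟩ ⟨h1, h2, h3⟩ τ _
    have key := pairWeight_generator hN hM hMN h1 h2 h3
    have hψ := one_le_pairWeight (N := N) (M := M) x y
    simp only at key hψ ⊢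
    set ψ := pairWeight N M x y with hψd
    set E := Real.exp (κ * τ) with hE
    have hE0 : 0 < E := Real.exp_pos _
    have hb : ∀ b ∈ bonds N, ∑ a : Bool,
        (q ^ (countStep (i, x, y) b a).1 * pairWeight N M (countStep (i, x, y) b a).2.1
          (countStep (i, x, y) b a).2.2 * E - q ^ i * ψ * E) ≤
        q ^ i * E * (if Touch b x y then 2 * δ * ψ else
          pairWeight N M (exchange b true x) (exchange b true y) - ψ) := by
      intro b _
      simp only [countStep, Fintype.sum_bool]
      split_ifs with hT
      · rw [pairWeight_exchange_of_touch hT, pairWeight_exchange_of_touch hT, ← hψd]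
        have h5 : q ^ (i - 1) * (ψ * E) ≤ (1 + δ) * q ^ i * (ψ * E) :=
          mul_le_mul_of_nonneg_right (hqj i) (by positivity)
        linarith
      · rw [exchange_false, exchange_false, ← hψd]
        exact le_of_eq (by ring)
    calc r / 2 * _ ≤ r / 2 * ∑ b ∈ bonds N, q ^ i * E * (if Touch b x y then 2 * δ * ψ else
          pairWeight N M (exchange b true x) (exchange b true y) - ψ) :=
          mul_le_mul_of_nonneg_left (Finset.sum_le_sum hb) (by positivity)
      _ = r / 2 * (q ^ i * E) * ∑ b ∈ bonds N, (if Touch b x y then 2 * δ * ψ else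
          pairWeight N M (exchange b true x) (exchange b true y) - ψ) := by
          rw [← Finset.mul_sum, ← mul_assoc]
      _ ≤ r / 2 * (q ^ i * E) * (14 / (M : ℝ) ^ 2 * ψ) :=
          mul_le_mul_of_nonneg_left key (by positivity)
      _ = q ^ i * ψ * (E * κ) := by rw [hκ]; ring
  · filter_upwards [ae_regular hε (bonds N)] with ω hg hω n
    exact hg.mem_cascade_of_le_numMarks hN n hx hy hω

theorem numMarks_self (N : ℕ) (x : ℤ) (t : ℝ) (ω : Marks) : numMarks N x x t ω = 0 := by
  rw [numMarks, Set.encard_eq_zero]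
  ext p
  simp [contactMarks, contactTimes]

theorem natCeil_le_of_ofReal_le {a : ℝ} {n : ℕ∞} (h : ENNReal.ofReal a ≤ (n : ℝ≥0∞)) :
    ((⌈a⌉₊ : ℕ) : ℕ∞) ≤ n := by
  induction n with
  | top => exact le_top
  | coe m =>
    rw [ENat.toENNReal_coe, ENNReal.ofReal_le_natCast] at h
    exact_mod_cast Nat.ceil_le.2 h

end NumberOfMarks

end Stirring

/-! ### Choice of the scale `M` and conclusion. -/

theorem Stirring.tau_bound {N : ℕ} {ε t : ℝ} (hN : 1 ≤ N) (hε : ε = 1 / (N : ℝ)) (ht : 0 ≤ t)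
    {x y : ℤ} (hx : x ∈ box N) (hy : y ∈ box N) (hxy : |x - y| = 1) :
    (marksLaw ε).real {ω | (t : EReal) ≤ tau N x y ω} ≤
      4 / ((ε⁻¹ ^ 2 * t) ^ (1 / 2 : ℝ) + 1) := by
  have hN0 : (1 : ℝ) ≤ N := by exact_mod_cast hN
  have hε0 : 0 < ε := by rw [hε]; positivity
  have := isProbabilityMeasure_marksLaw hε0
  rw [← Real.sqrt_eq_rpow]
  set q : ℝ := √(ε⁻¹ ^ 2 * t) with hq
  have hq0 : 0 ≤ q := Real.sqrt_nonneg _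
  have hqs : q ^ 2 = ε⁻¹ ^ 2 * t := Real.sq_sqrt (by positivity)
  rcases lt_or_ge q 2 with h | h
  · refine measureReal_le_one.trans ?_
    rw [le_div_iff₀ (by linarith)]
    linarith
  · have ht0 : 0 < t := by
      rcases ht.eq_or_lt with h0 | h0
      · rw [← h0, mul_zero] at hqs
        nlinarith
      · exact h0
    have hM2 : 2 ≤ ⌊q⌋₊ := Nat.le_floor (by exact_mod_cast h)
    have hMq : ((⌊q⌋₊ : ℕ) : ℝ) ≤ q := Nat.floor_le hq0
    have hqM : q < (⌊q⌋₊ : ℕ) + 1 := Nat.lt_floor_add_one q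
    have hM2' : (2 : ℝ) ≤ (⌊q⌋₊ : ℕ) := by exact_mod_cast hM2
    set M := ⌊q⌋₊
    refine (marksLaw_le_tau_le hN hε0 ht0 hM2 (by rw [← hqs]; gcongr) hx hy hxy).trans ?_
    rw [← hqs]
    -- Since `M ≥ 2`, the floor satisfies `q < M + 1 ≤ 3M/2`.
    have h1 : 1 / (M : ℝ) ≤ 3 / 2 / q := by
      rw [div_le_div_iff₀ (by linarith) (by linarith)]
      linarith
    have h2 : (M : ℝ) / (2 * q ^ 2) ≤ 1 / 2 / q := by
      rw [div_le_div_iff₀ (by positivity) (by linarith)]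
      nlinarith
    have h3 : 2 / q ≤ 4 / (q + 1) := by
      rw [div_le_div_iff₀ (by linarith) (by linarith)]
      linarith
    have h4 : 3 / 2 / q + 1 / 2 / q = 2 / q := by ring
    linarith

/-- Stretched exponential decay beats any power. -/
theorem Stirring.exp_neg_rpow_le {a ζ k : ℝ} (ha : 0 < a) (hζ : 0 < ζ) :
    ∃ C : ℝ, 0 ≤ C ∧ ∀ n : ℝ, 1 ≤ n → Real.exp (-(n ^ ζ / a)) ≤ C * n ^ (-k) := by
  obtain ⟨p, hp⟩ := exists_nat_ge (k / ζ)
  refine ⟨p.factorial * a ^ p, by positivity, fun n hn => ?_⟩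
  have hn0 : 0 < n := by linarith
  have hy : 0 < n ^ ζ / a := by positivity
  have h1 := Real.pow_div_factorial_le_exp (n ^ ζ / a) hy.le p
  have h2 : n ^ k ≤ (n ^ ζ) ^ p := by
    rw [← Real.rpow_natCast, ← Real.rpow_mul hn0.le]
    refine Real.rpow_le_rpow_of_exponent_le hn ?_
    rw [div_le_iff₀ hζ] at hp
    linarith
  rw [Real.exp_neg, Real.rpow_neg hn0.le, ← div_eq_mul_inv, le_div_iff₀ (by positivity),
    inv_mul_le_iff₀ (Real.exp_pos _)]
  rw [div_pow, div_div, div_le_iff₀ (by positivity)] at h1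
  calc n ^ k ≤ (n ^ ζ) ^ p := h2
    _ ≤ _ := h1
    _ = _ := by ring

theorem Stirring.numMarks_bound {T ζ k : ℝ} (hT : 0 < T) (hζ : 0 < ζ) (hk : 1 ≤ k) :
    ∃ c : ℝ, ∀ t : ℝ, 0 < t → t ≤ T → ∀ (N : ℕ) (ε : ℝ), 1 ≤ N → ε = 1 / (N : ℝ) →
      ∀ x ∈ box N, ∀ y ∈ box N,
        (marksLaw ε).real {ω | ENNReal.ofReal ((ε⁻¹ ^ 2 * t) ^ (1 / 2 + ζ)) ≤
          (numMarks N x y t ω : ENNReal)} ≤ c * (ε⁻¹ ^ 2 * t) ^ (-k) := by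
  -- Chosen so that `5M ≤ a √n` for the scale `M` below.
  set a : ℝ := 5 * (1 / √T + 1) with ha
  have ha0 : 0 < a := by positivity
  obtain ⟨C, hC0, hC⟩ := exp_neg_rpow_le (k := k) ha0 hζ
  refine ⟨1 + 6 * Real.exp (7 * T) * C, fun t ht htT N ε hN hε x hx y hy => ?_⟩
  have hN0 : (1 : ℝ) ≤ N := by exact_mod_cast hN
  have hε0 : 0 < ε := by rw [hε]; positivity
  have := isProbabilityMeasure_marksLaw hε0
  have hεN : ε⁻¹ = N := by rw [hε]; simp
  set n : ℝ := ε⁻¹ ^ 2 * t with hn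
  have hn0 : 0 < n := by positivity
  have hnk : 0 ≤ n ^ (-k) := by positivity
  have hE0 : 0 ≤ 6 * Real.exp (7 * T) * C := by positivity
  rcases lt_or_ge n 1 with hn1 | hn1
  · have h1 : 1 ≤ n ^ (-k) :=
      Real.one_le_rpow_of_pos_of_le_one_of_nonpos hn0 hn1.le (by linarith)
    refine measureReal_le_one.trans ?_
    nlinarith
  by_cases hxy : x = y
  · subst hxy
    have : {ω | ENNReal.ofReal (n ^ (1 / 2 + ζ)) ≤ (numMarks N x x t ω : ENNReal)} = ∅ := by
      ext ω
      have h0 : 0 < n ^ (1 / 2 + ζ) := by positivity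
      simpa [numMarks_self] using h0
    rw [this, measureReal_empty]
    positivity
  -- This is the scale at which `n / M² ≤ T`, and it fits in the box: `t ≤ T` gives `n / T ≤ N²`,
  -- hence `M ≤ N`.
  set M : ℕ := ⌈√(n / T)⌉₊ with hM
  have hM1 : 1 ≤ M := Nat.one_le_ceil_iff.2 (by positivity)
  have hM1' : (1 : ℝ) ≤ M := by exact_mod_cast hM1
  have hMN : M ≤ N := by
    refine Nat.ceil_le.2 (Real.sqrt_le_iff.2 ⟨by positivity, ?_⟩)
    rw [div_le_iff₀ hT, hn, hεN]
    gcongr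
  have hMl : √(n / T) ≤ M := Nat.le_ceil _
  have hMu : (M : ℝ) ≤ √n * (1 / √T + 1) := by
    have h1 := (Nat.ceil_lt_add_one (Real.sqrt_nonneg (n / T))).le
    rw [Real.sqrt_div hn0.le] at h1
    have h2 : 1 ≤ √n := Real.one_le_sqrt.2 hn1
    have h3 : √n * (1 / √T + 1) = √n / √T + √n := by ring
    rw [h3]
    exact h1.trans (by linarith) |>.trans' (by rw [hM, Real.sqrt_div hn0.le])
  set j : ℕ := ⌈n ^ (1 / 2 + ζ)⌉₊ with hj
  have hjl : n ^ (1 / 2 + ζ) ≤ j := Nat.le_ceil _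
  have hexp : Real.exp (7 * n / (M : ℝ) ^ 2) ≤ Real.exp (7 * T) := by
    refine Real.exp_le_exp.2 ?_
    have h1 : n / T ≤ (M : ℝ) ^ 2 := by
      rw [← Real.sq_sqrt (by positivity : 0 ≤ n / T)]
      gcongr
    rw [div_le_iff₀ hT] at h1
    rw [div_le_iff₀ (by positivity)]
    linarith
  have hpow : ((1 + 1 / (4 * M : ℝ))⁻¹) ^ j ≤ Real.exp (-(n ^ ζ / a)) := by
    -- The loss from `4` to `5` makes `(1 - 1/(5M)) (1 + 1/(4M)) ≥ 1` for all `M ≥ 1`.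
    have h1 : (1 + 1 / (4 * M : ℝ))⁻¹ ≤ Real.exp (-(1 / (5 * M))) := by
      have h2 := Real.add_one_le_exp (-(1 / (5 * M : ℝ)))
      refine le_trans ?_ h2
      rw [inv_le_iff_one_le_mul₀ (by positivity)]
      have : (-(1 / (5 * M : ℝ)) + 1) * (1 + 1 / (4 * M)) = 1 + (M - 1) / (20 * M ^ 2) := by
        field_simp; ring
      rw [this]
      have : 0 ≤ ((M : ℝ) - 1) / (20 * M ^ 2) := div_nonneg (by linarith) (by positivity)
      linarith
    calc ((1 + 1 / (4 * M : ℝ))⁻¹) ^ j ≤ Real.exp (-(1 / (5 * M))) ^ j :=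
          pow_le_pow_left₀ (by positivity) h1 j
      _ = Real.exp (-(j / (5 * M))) := by rw [← Real.exp_nat_mul]; congr 1; ring
      _ ≤ Real.exp (-(n ^ ζ / a)) := by
          refine Real.exp_le_exp.2 (neg_le_neg ?_)
          rw [div_le_div_iff₀ ha0 (by positivity)]
          have h3 : n ^ (1 / 2 + ζ) = √n * n ^ ζ := by
            rw [Real.rpow_add hn0, Real.sqrt_eq_rpow]
          rw [h3] at hjl
          have h4 : 0 ≤ n ^ ζ := by positivity
          calc n ^ ζ * (5 * M) ≤ n ^ ζ * (5 * (√n * (1 / √T + 1))) := by gcongr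
            _ = √n * n ^ ζ * a := by rw [ha]; ring
            _ ≤ j * a := by gcongr
  have hsub : {ω | ENNReal.ofReal (n ^ (1 / 2 + ζ)) ≤ (numMarks N x y t ω : ENNReal)} ⊆
      {ω | (j : ℕ∞) ≤ numMarks N x y t ω} := fun ω hω => natCeil_le_of_ofReal_le hω
  calc _ ≤ (marksLaw ε).real {ω | (j : ℕ∞) ≤ numMarks N x y t ω} := measureReal_mono hsub
    _ ≤ 6 * Real.exp (7 * n / (M : ℝ) ^ 2) * ((1 + 1 / (4 * M : ℝ))⁻¹) ^ j :=
        marksLaw_le_numMarks_le hN hε0 ht.le hM1 hMN hx hy hxy j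
    _ ≤ 6 * Real.exp (7 * T) * (C * n ^ (-k)) := by
        gcongr
        exact hpow.trans (hC n hn1)
    _ ≤ (1 + 6 * Real.exp (7 * T) * C) * n ^ (-k) := by nlinarith

end

theorem theorem4p4 :
    (∃ c : ℝ, ∀ (N : ℕ) (ε : ℝ), 1 ≤ N → ε = 1 / (N : ℝ) →
      ∀ t : ℝ, 0 ≤ t → ∀ x₁ ∈ Stirring.box N, ∀ x₂ ∈ Stirring.box N, |x₁ - x₂| = 1 →
        (Stirring.marksLaw ε).real {ω | (t : EReal) ≤ Stirring.tau N x₁ x₂ ω} ≤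
          c / ((ε⁻¹ ^ 2 * t) ^ (1 / 2 : ℝ) + 1)) ∧
    (∀ T : ℝ, 0 < T → ∀ ζ : ℝ, 0 < ζ → ∀ k : ℝ, 1 ≤ k →
      ∃ c : ℝ, ∀ t : ℝ, 0 < t → t ≤ T →
        ∀ (N : ℕ) (ε : ℝ), 1 ≤ N → ε = 1 / (N : ℝ) →
          ∀ x₁ ∈ Stirring.box N, ∀ x₂ ∈ Stirring.box N,
            (Stirring.marksLaw ε).real
                {ω | ENNReal.ofReal ((ε⁻¹ ^ 2 * t) ^ (1 / 2 + ζ)) ≤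
                  (Stirring.numMarks N x₁ x₂ t ω : ENNReal)} ≤
              c * (ε⁻¹ ^ 2 * t) ^ (-k)) :=
  ⟨⟨4, fun _ _ hN hε _ ht _ h₁ _ h₂ h => Stirring.tau_bound hN hε ht h₁ h₂ h⟩,
    fun _ hT _ hζ _ hk => Stirring.numMarks_bound hT hζ hk⟩
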